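/- Let $B=(V,E)$ be a stationary Bratteli diagram: the level sets $V_n$ and edge sets $E_n$ are finite, $V_0=\{v_0\}$, edges in $E_{n+1}$ go from $V_n$ to $V_{n+1}$, every vertex emits an edge and every vertex other than $v_0$ receives one, and, with each $V_n$ ($n\ge 1$) numbered by $\{1,\dots,N\}$, the number of edges from $w\in V_n$ to $v\in V_{n+1}$ is $f_{vw}$ for all $n\ge 1$, where the incidence matrix $F=(f_{vw})$ does not depend on $n$. Let $X_B$ be the space of infinite paths starting at $v_0$, with the topology generated by cylinder sets, and let $\mathcal R$ be the tail equivalence relation on $X_B$ (two paths are equivalent if they agree from some level on). Assume that $\mathcal R$ is aperiodic (all its classes are infinite) and that in the Frobenius normal form of $F$ every nonzero diagonal block is primitive, i.e. the restriction of $F$ to each communicating class of vertices is zero or primitive. Put $A=F^T$, $core(A)=\bigcap_{k\ge 1}A^k(\mathbb R_+^N)$, let $h^{(1)}_w$ be the number of edges from $v_0$ to $w\in V_1$, let $X^{(1)}_w\subset X_B$ be the set of paths through $w\in V_1$, and let $D=\{x\in core(A):\sum_{w\in V_1}h^{(1)}_wx_w=1\}$. A Borel measure is $\mathcal R$-invariant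 if it is invariant under the Borel action of any countable group whose orbits are the classes of $\mathcal R$, and an $\mathcal R$-invariant probability measure is ergodic if every $\mathcal R$-invariant Borel set is null or co-null. For a communicating class $\alpha$ of $A$ let $\rho_\alpha$ be the spectral radius of the restriction of $A$ to $\alpha$; $\alpha$ is distinguished if $\rho_\alpha>\rho_\beta$ for every class $\beta\ne\alpha$ that has access to $\alpha$ in the directed graph $G(A)$, which has an arrow $i\to j$ iff $A_{ij}>0$. A distinguished eigenvector for a distinguished class $\alpha$ is a non-negative $x$ with $Ax=\rho_\alpha x$ and $x_i>0$ exactly when the vertex $i$ has access to $\alpha$ in $G(A)$. A face of a convex cone $C$ is a subcone $Q\subset C$ such that $x\in Q$, $y\in C$, $x-y\in C$ imply $y\in Q$. An extreme vector of $C$ is a nonzero vector $x\in C$ such that the smallest face of $C$ containing $x$ is the ray generated by $x$; this ray is then called an extreme ray. Then: 1. The map $\mu\mapsto p^{(1)}=\bigl(\mu(X^{(1)}_w)/h^{(1)}_w\bigr)_{w\in V_1}$ is a bijection from the set of $\mathcal R$-invariant Borel probability measures on $X_B$ onto $D$, and it is affine. 2. An $\mathcal R$-invariant probability measure is ergodic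 if and only if its vector $p^{(1)}$ is an extreme vector of $core(A)$. The extreme vectors of $core(A)$ are exactly the distinguished eigenvectors of $A$, and every distinguished class $\alpha$ has exactly one ergodic $\mathcal R$-invariant probability measure whose vector $p^{(1)}$ is a distinguished eigenvector for $\alpha$. 3. In particular, there are finitely many ergodic $\mathcal R$-invariant probability measures; their number is equal to the number of extreme rays of $core(A)$ and to the number of distinguished classes of $A$. -/

import Mathlib

open MeasureTheory
open scoped NNReal Matrix

/-! ### Bratteli diagrams, path space, tail equivalence, invariant measures -/

universe u v

/-- A Bratteli diagram. `V n` is the finite set of vertices of level `n`, and `E n` is the finite set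
of edges from level `n` to level `n + 1` (usually called `E_{n+1}`). Level `0` is one point,
every vertex emits an edge and every vertex of level at least `1` receives one. -/
structure BratteliDiagram where
  V : ℕ → Type u
  E : ℕ → Type v
  finite_V : ∀ n, Finite (V n)
  finite_E : ∀ n, Finite (E n)
  root_unique : ∃! _v₀ : V 0, True
  s : ∀ {n : ℕ}, E n → V n
  r : ∀ {n : ℕ}, E n → V (n + 1)
  s_surjective : ∀ n, Function.Surjective (s (n := n))
  r_surjective : ∀ n, Function.Surjective (r (n := n))

namespace BratteliDiagram

variable (B : BratteliDiagram.{u, v})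

/-- The path space `X_B`: infinite paths starting at the root. -/
@[ext] structure PathSpace where
  edge : ∀ n, B.E n
  compat : ∀ n, B.r (edge n) = B.s (edge (n + 1))

variable {B}

/-- The set of infinite paths whose first `n` edges are those of `x`.
Every finite path from the root extends to an infinite one, so these are all the cylinder sets. -/
def cylinder (x : B.PathSpace) (n : ℕ) : Set B.PathSpace :=
  {y | ∀ i < n, y.edge i = x.edge i}

instance : TopologicalSpace B.PathSpace :=
  TopologicalSpace.generateFrom {U | ∃ x n, U = cylinder x n}

instance : MeasurableSpace B.PathSpace := borel _

instance : BorelSpace B.PathSpace := ⟨rfl⟩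

/-- Tail (cofinal) equivalence of infinite paths. -/
def TailEquiv (x y : B.PathSpace) : Prop :=
  ∃ i₀, ∀ i ≥ i₀, x.edge i = y.edge i

variable (B) in
/-- All classes of the tail equivalence relation are infinite. -/
def IsAperiodic : Prop := ∀ x : B.PathSpace, {y | TailEquiv x y}.Infinite

variable (B) in
/-- The number of edges with range `v` and source `w`: the `(v, w)` entry of the `n`-th incidence
matrix. -/
noncomputable def incidence (n : ℕ) (v : B.V (n + 1)) (w : B.V n) : ℕ :=
  Nat.card {e : B.E n // B.r e = v ∧ B.s e = w}

variable (B) in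
/-- With every level `n ≥ 1` numbered by `Fin N` through `num`, all the incidence matrices between
consecutive levels `n ≥ 1` are equal to `F`. -/
def IsStationary {N : ℕ} (F : Matrix (Fin N) (Fin N) ℕ) (num : ∀ n, Fin N ≃ B.V (n + 1)) : Prop :=
  ∀ n i j, B.incidence (n + 1) (num (n + 1) i) (num n j) = F i j

variable (B) in
/-- `h_w^{(1)}`, the number of paths from the root to a vertex `w` of level `1`. Such a path is a
single edge, and its source is automatically the root. -/
noncomputable def height₁ (w : B.V 1) : ℕ := Nat.card {e : B.E 0 // B.r e = w}

/-- `X_w^{(1)}`, the set of infinite paths through the vertex `w` of level `1`. -/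
def tower₁ (w : B.V 1) : Set B.PathSpace := {x | B.r (x.edge 0) = w}

/-- `μ` is invariant for the tail equivalence relation: it is invariant under the Borel action of
any countable group whose orbits are the classes of the relation. -/
def IsInvariant (μ : Measure B.PathSpace) : Prop :=
  ∀ G : Subgroup (Equiv.Perm B.PathSpace), Countable G →
    (∀ g ∈ G, Measurable g) →
    (∀ x y, TailEquiv x y ↔ ∃ g ∈ G, g x = y) →
    ∀ g ∈ G, μ.map g = μ

variable (B) in
/-- The set of invariant Borel probability measures. -/
def invariantProb : Set (Measure B.PathSpace) :=
  {μ | IsProbabilityMeasure μ ∧ IsInvariant μ}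

/-- Ergodicity: every Borel set that is a union of tail classes is null or co-null. -/
def IsErgodic (μ : Measure B.PathSpace) : Prop :=
  ∀ S : Set B.PathSpace, MeasurableSet S → (∀ x y, TailEquiv x y → (x ∈ S ↔ y ∈ S)) →
    μ S = 0 ∨ μ Sᶜ = 0

variable (B) in
/-- The set of ergodic invariant Borel probability measures. -/
def ergodicProb : Set (Measure B.PathSpace) := {μ | μ ∈ B.invariantProb ∧ IsErgodic μ}

/-- The vector `(μ(X_w^{(1)}) / h_w^{(1)})_w`. -/
noncomputable def measureVector {N : ℕ} (num : ∀ n, Fin N ≃ B.V (n + 1))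
    (μ : Measure B.PathSpace) : Fin N → ℝ :=
  fun i => μ.real (tower₁ (num 0 i)) / (B.height₁ (num 0 i) : ℝ)

end BratteliDiagram

/-! ### Cones -/

/-- A set closed under linear combinations with non-negative coefficients. -/
def IsConvexCone {N : ℕ} (C : Set (Fin N → ℝ)) : Prop :=
  ∀ x ∈ C, ∀ y ∈ C, ∀ a b : ℝ, 0 ≤ a → 0 ≤ b → a • x + b • y ∈ C

/-- A face of `C`: a subcone `Q` such that `x ∈ Q`, `y ∈ C`, `x - y ∈ C` imply `y ∈ Q`. -/
def IsFace {N : ℕ} (C Q : Set (Fin N → ℝ)) : Prop :=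
  Q ⊆ C ∧ IsConvexCone Q ∧ ∀ x ∈ Q, ∀ y ∈ C, x - y ∈ C → y ∈ Q

/-- The minimal face of `C` that contains `x`. -/
def minimalFace {N : ℕ} (C : Set (Fin N → ℝ)) (x : Fin N → ℝ) : Set (Fin N → ℝ) :=
  ⋂₀ {Q | IsFace C Q ∧ x ∈ Q}

/-- The ray generated by `x`. -/
def rayOf {N : ℕ} (x : Fin N → ℝ) : Set (Fin N → ℝ) := {y | ∃ a : ℝ, 0 ≤ a ∧ y = a • x}

/-- A nonzero vector of `C` whose minimal face is the ray that it generates. -/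
def IsExtremeVector {N : ℕ} (C : Set (Fin N → ℝ)) (x : Fin N → ℝ) : Prop :=
  x ∈ C ∧ x ≠ 0 ∧ minimalFace C x = rayOf x

/-- The set of extreme rays of `C`. -/
def extremeRays {N : ℕ} (C : Set (Fin N → ℝ)) : Set (Set (Fin N → ℝ)) :=
  {R | ∃ x, IsExtremeVector C x ∧ R = rayOf x}

/-! ### Non-negative matrices -/

/-- The core of `A`: the intersection of the images of the non-negative orthant under `A ^ k`,
`k ≥ 1`. -/
def matrixCore {N : ℕ} (A : Matrix (Fin N) (Fin N) ℝ) : Set (Fin N → ℝ) :=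
  ⋂ k ≥ 1, (fun y => (A ^ k) *ᵥ y) '' {y | 0 ≤ y}

/-- There is a (possibly empty) path from `i` to `j` in the directed graph with an arrow from `k` to
`l` whenever `A k l > 0`. -/
def VertexAccess {N : ℕ} (A : Matrix (Fin N) (Fin N) ℝ) (i j : Fin N) : Prop :=
  Relation.ReflTransGen (fun k l => 0 < A k l) i j

/-- `i` and `j` communicate: `i = j`, or there are paths from `i` to `j` and from `j` to `i`. -/
def communicates {N : ℕ} (A : Matrix (Fin N) (Fin N) ℝ) : Setoid (Fin N) where
  r i j := VertexAccess A i j ∧ VertexAccess A j i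
  iseqv :=
    { refl := fun _ => ⟨Relation.ReflTransGen.refl, Relation.ReflTransGen.refl⟩
      symm := fun h => ⟨h.2, h.1⟩
      trans := fun h h' => ⟨h.1.trans h'.1, h'.2.trans h.2⟩ }

/-- The communicating classes of `A`, which are the vertices of the reduced graph. -/
abbrev ComClass {N : ℕ} (A : Matrix (Fin N) (Fin N) ℝ) : Type := Quotient (communicates A)

/-- The vertices that belong to a class. -/
abbrev ComClass.Members {N : ℕ} {A : Matrix (Fin N) (Fin N) ℝ} (α : ComClass A) : Type :=
  {i : Fin N // Quotient.mk (communicates A) i = α}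

noncomputable instance {N : ℕ} {A : Matrix (Fin N) (Fin N) ℝ} (α : ComClass A) :
    Fintype α.Members := Fintype.ofFinite _

/-- The diagonal block of `A` that belongs to the class `α`. -/
def diagBlock {N : ℕ} (A : Matrix (Fin N) (Fin N) ℝ) (α : ComClass A) :
    Matrix α.Members α.Members ℝ :=
  A.submatrix Subtype.val Subtype.val

/-- Every nonzero diagonal block, in the Frobenius normal form of `A`, is primitive. The diagonal
blocks are the restrictions of `A` to its communicating classes; the normal form itself is only a
suitable numbering of the vertices and exists for every non-negative matrix. -/
def HasPrimitiveBlocks {N : ℕ} (A : Matrix (Fin N) (Fin N) ℝ) : Prop :=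
  ∀ α : ComClass A, diagBlock A α ≠ 0 → (diagBlock A α).IsPrimitive

/-- The spectral radius `ρ_α` of the diagonal block of the class `α`, the largest modulus of a
complex eigenvalue. -/
noncomputable def classRadius {N : ℕ} (A : Matrix (Fin N) (Fin N) ℝ) (α : ComClass A) : ℝ :=
  (spectralRadius ℂ ((diagBlock A α).map (fun t : ℝ => (t : ℂ)))).toReal

/-- The class `β` has access to the class `α`: they are equal, or there is a path from a vertex of
`β` to a vertex of `α`. -/
def ClassAccess {N : ℕ} (A : Matrix (Fin N) (Fin N) ℝ) (β α : ComClass A) : Prop :=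
  β = α ∨ ∃ (i : β.Members) (j : α.Members), VertexAccess A i j

/-- The class `α` is distinguished: `ρ_β < ρ_α` for all other classes `β` with access to `α`. -/
def IsDistinguished {N : ℕ} (A : Matrix (Fin N) (Fin N) ℝ) (α : ComClass A) : Prop :=
  ∀ β : ComClass A, β ≠ α → ClassAccess A β α → classRadius A β < classRadius A α

/-- `x` is a distinguished eigenvector for the class `α`: a non-negative eigenvector with eigenvalue
`ρ_α` whose positive coordinates are those of the vertices that have access to `α`. -/
def IsDistinguishedEigenvector {N : ℕ} (A : Matrix (Fin N) (Fin N) ℝ) (α : ComClass A)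
    (x : Fin N → ℝ) : Prop :=
  A *ᵥ x = classRadius A α • x ∧ 0 ≤ x ∧
    ∀ i, 0 < x i ↔ ∃ j : α.Members, VertexAccess A i j

/-- The vectors `x` of the core of `A` with `∑ w, h w * x w = 1`. -/
def normalizedCore {N : ℕ} (A : Matrix (Fin N) (Fin N) ℝ) (h : Fin N → ℕ) : Set (Fin N → ℝ) :=
  {x | x ∈ matrixCore A ∧ ∑ w, (h w : ℝ) * x w = 1}

/-! ### Perron–Frobenius theory of primitive matrices -/

section Perron

variable {n : Type*} [Fintype n]

/-! Everything is expressed through backward orbits of $A=F^T$: sequences $y_k\ge 0$ with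
$Ay_{k+1}=y_k$.

Measures. Tail equivalence is generated by countably many exchanges of initial segments, so a finite
measure is invariant exactly when the mass of a cylinder depends only on its last vertex
(`isInvariant_iff_cylinder`). Splitting a cylinder along its next edge shows that these masses form
a backward orbit. Conversely, a backward orbit supplies the transition probabilities of a Markov
measure, built by the Ionescu-Tulcea theorem (`exists_measure_of_weights`). Even when $A$ is
singular it acts bijectively on its core, because the core lies in the stable range of $A$. So each
core vector starts exactly one backward orbit, and the vector $p^{(1)}$ determines the measure. The
condition $\sum_w h^{(1)}_w x_w=1$ says that the total mass is 1.

Ergodicity. Sums of finite invariant measures correspond to sums in the core. An invariant measure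
dominated by an ergodic one is a multiple of it, since its Radon-Nikodym derivative is invariant;
conversely, a saturated set splits the measure into two invariant parts. Hence ergodic means extreme
(`isErgodic_iff_isExtremeVector`).

The core. A backward orbit of a primitive block is $c\,r^{-k}u$ with $u$ its Perron vector
(`Matrix.IsPrimitive.backward_orbit`). In the support of a backward orbit of $A$, choose a class
$\alpha$ with no arrows to the rest of the support. On it the orbit is $c\,\rho_\alpha^{-k}u$. If
$c>0$, then $y_0=A^my_m$ bounds the vectors $\rho_\alpha^{-m}A^mu$; their increasing limit
$X_\alpha$ is a distinguished eigenvector, and its existence forces $\alpha$ to be distinguished. As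
$X_\alpha$ is the least bound, the orbit $c\,\rho_\alpha^{-k}X_\alpha$ can be subtracted, which
removes $\alpha$ from the support. Induction shows that the core is generated by the $X_\alpha$
(`exists_matrixCore_generators`). Each $X_\alpha$ is extreme: another $X_\beta$ below it in the
order of the core would need $\rho_\beta<\rho_\alpha$, and then $\rho_\beta^{-k}X_\beta$ would
outgrow $\rho_\alpha^{-k}X_\alpha$. -/

theorem Matrix.mulVec_nonneg {P : Matrix n n ℝ} (hP : ∀ i j, 0 ≤ P i j) {x : n → ℝ} (hx : 0 ≤ x) :
    0 ≤ P *ᵥ x :=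
  fun i => Finset.sum_nonneg fun j _ => mul_nonneg (hP i j) (hx j)

theorem Matrix.mulVec_mono_of_nonneg {P : Matrix n n ℝ} (hP : ∀ i j, 0 ≤ P i j) {x y : n → ℝ}
    (h : x ≤ y) : P *ᵥ x ≤ P *ᵥ y :=
  fun i => Finset.sum_le_sum fun j _ => mul_le_mul_of_nonneg_left (h j) (hP i j)

theorem Matrix.mulVec_pos_of_pos {P : Matrix n n ℝ} (hP : ∀ i j, 0 < P i j) {x : n → ℝ}
    (hx : 0 ≤ x) (hx0 : x ≠ 0) (i : n) : 0 < (P *ᵥ x) i := by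
  obtain ⟨j, hj⟩ := Function.ne_iff.1 hx0
  exact Finset.sum_pos' (fun k _ => mul_nonneg (hP i k).le (hx k))
    ⟨j, Finset.mem_univ j, mul_pos (hP i j) (lt_of_le_of_ne (hx j) (Ne.symm hj))⟩

variable [DecidableEq n]

theorem Matrix.pow_nonneg_entries {P : Matrix n n ℝ} (hP : ∀ i j, 0 ≤ P i j) (k : ℕ) :
    ∀ i j, 0 ≤ (P ^ k) i j := by
  induction k with
  | zero =>
    intro i j
    rw [pow_zero, Matrix.one_apply]
    split_ifs <;> norm_num
  | succ k ih =>
    intro i j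
    rw [pow_succ, Matrix.mul_apply]
    exact Finset.sum_nonneg fun l _ => mul_nonneg (ih i l) (hP l j)

theorem Matrix.pow_mulVec_of_eigen {P : Matrix n n ℝ} {t : ℝ} {x : n → ℝ} (h : P *ᵥ x = t • x)
    (k : ℕ) : (P ^ k) *ᵥ x = t ^ k • x := by
  induction k with
  | zero => simp
  | succ k ih => rw [pow_succ, ← Matrix.mulVec_mulVec, h, Matrix.mulVec_smul, ih, smul_smul, pow_succ']

theorem Matrix.pow_mulVec_backward {P : Matrix n n ℝ} {y : ℕ → n → ℝ}
    (h : ∀ k, P *ᵥ y (k + 1) = y k) (k l : ℕ) : (P ^ k) *ᵥ y (l + k) = y l := by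
  induction k with
  | zero => simp
  | succ k ih => rw [pow_succ, ← Matrix.mulVec_mulVec, ← add_assoc, h, ih]

theorem Matrix.pow_mulVec_succ (P : Matrix n n ℝ) (k : ℕ) (x : n → ℝ) :
    P *ᵥ ((P ^ k) *ᵥ x) = (P ^ (k + 1)) *ᵥ x := by
  rw [Matrix.mulVec_mulVec, pow_succ']

/-- A primitive matrix has a positive eigenvector with a positive eigenvalue. -/
theorem Matrix.IsPrimitive.exists_pos_eigenvector [Nonempty n] {P : Matrix n n ℝ}
    (hP : P.IsPrimitive) :
    ∃ r : ℝ, 0 < r ∧ ∃ x : n → ℝ, (∀ i, 0 < x i) ∧ P *ᵥ x = r • x := by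
  obtain ⟨h0, k, hk, hpos⟩ := hP
  -- Collatz-Wielandt: the eigenvalue is the largest $t$ with $tx\le Px$ for some $x$ in the
  -- simplex. The upper bound on $t$ follows from the other conditions and is imposed only for
  -- compactness.
  let K : Set (ℝ × (n → ℝ)) :=
    {p | p.1 ∈ Set.Icc 0 (∑ i, ∑ j, P i j) ∧ p.2 ∈ stdSimplex ℝ n ∧ ∀ i, p.1 * p.2 i ≤ (P *ᵥ p.2) i}
  have hKeq : K = (Set.Icc 0 (∑ i, ∑ j, P i j) ×ˢ stdSimplex ℝ n) ∩
      ⋂ i, {p | p.1 * p.2 i ≤ (P *ᵥ p.2) i} := by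
    ext p
    simp [K, and_assoc]
  have hKc : IsCompact K := by
    rw [hKeq]
    refine (isCompact_Icc.prod (isCompact_stdSimplex ℝ n)).inter_right ?_
    refine isClosed_iInter fun i => isClosed_le (by fun_prop) ?_
    simp only [Matrix.mulVec, dotProduct]
    fun_prop
  have hmem : ∀ (t : ℝ) (x : n → ℝ), 0 ≤ t → x ∈ stdSimplex ℝ n → (∀ i, t * x i ≤ (P *ᵥ x) i) →
      (t, x) ∈ K := by
    intro t x ht hx h
    refine ⟨⟨ht, ?_⟩, hx, h⟩
    calc t = ∑ i, t * x i := by rw [← Finset.mul_sum, hx.2, mul_one]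
      _ ≤ ∑ i, (P *ᵥ x) i := Finset.sum_le_sum fun i _ => h i
      _ ≤ ∑ i, ∑ j, P i j := by
        refine Finset.sum_le_sum fun i _ => Finset.sum_le_sum fun j _ => ?_
        have : x j ≤ 1 := by
          rw [← hx.2]
          exact Finset.single_le_sum (fun i _ => hx.1 i) (Finset.mem_univ j)
        exact mul_le_of_le_one_right (h0 i j) this
  have i₀ := Classical.arbitrary n
  have hKne : K.Nonempty := by
    refine ⟨(0, Pi.single i₀ 1), hmem 0 _ le_rfl (single_mem_stdSimplex ℝ i₀) fun i => ?_⟩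
    rw [zero_mul]
    exact Matrix.mulVec_nonneg h0 (single_mem_stdSimplex ℝ i₀).1 i
  obtain ⟨⟨t, x⟩, ⟨⟨ht, -⟩, hx, htx⟩, hmax⟩ :=
    hKc.exists_isMaxOn hKne (f := Prod.fst) continuous_fst.continuousOn
  simp only at ht hx htx
  have hx0 : x ≠ 0 := by
    rintro rfl
    simpa using hx.2
  have hPkx := Matrix.mulVec_pos_of_pos hpos hx.1 hx0
  have hz : 0 ≤ P *ᵥ x - t • x := fun i => by simpa using htx i
  -- A nonzero slack becomes strictly positive under $P^k$, so $y=P^kx$, once normalized, admits a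
  -- larger $t$, against maximality.
  have hzero : P *ᵥ x - t • x = 0 := by
    by_contra hne
    have hw := Matrix.mulVec_pos_of_pos hpos hz hne
    set w := (P ^ k) *ᵥ (P *ᵥ x - t • x) with hwdef
    set y := (P ^ k) *ᵥ x with hydef
    have hPy : P *ᵥ y = t • y + w := by
      rw [hwdef, Matrix.mulVec_sub, Matrix.mulVec_smul, hydef, Matrix.mulVec_mulVec,
        Matrix.mulVec_mulVec, ← pow_succ, ← pow_succ']
      abel
    obtain ⟨i₁, hi₁⟩ := Finite.exists_min fun i => w i / y i
    have hε : 0 < w i₁ / y i₁ := div_pos (hw _) (hPkx _)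
    have hs : 0 < ∑ i, y i := Finset.sum_pos (fun i _ => hPkx i) Finset.univ_nonempty
    have hK := hmem (t + w i₁ / y i₁) ((∑ i, y i)⁻¹ • y) (by linarith) ?_ ?_
    · have := hmax hK
      simp only [Set.mem_ofPred_eq] at this
      linarith
    · refine ⟨fun i => mul_nonneg (inv_nonneg.2 hs.le) (hPkx i).le, ?_⟩
      simp only [Pi.smul_apply, smul_eq_mul, ← Finset.mul_sum]
      exact inv_mul_cancel₀ hs.ne'
    · intro i
      rw [Matrix.mulVec_smul, hPy]
      simp only [Pi.smul_apply, Pi.add_apply, smul_eq_mul]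
      have h1 : w i₁ / y i₁ * y i ≤ w i := (le_div_iff₀ (hPkx i)).1 (hi₁ i)
      have h2 := mul_le_mul_of_nonneg_left h1 (inv_nonneg.2 hs.le)
      linarith
  have hPx : P *ᵥ x = t • x := sub_eq_zero.1 hzero
  have hpow := Matrix.pow_mulVec_of_eigen hPx k
  have hxi : ∀ i, 0 < t ^ k * x i := fun i => by
    have := hPkx i
    rwa [hpow] at this
  have htk : 0 < t := by
    rcases ht.eq_or_lt with h | h
    · have := hxi i₀
      rw [← h, zero_pow hk.ne', zero_mul] at this
      exact absurd this (lt_irrefl _)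
    · exact h
  exact ⟨t, htk, x, fun i => pos_of_mul_pos_right (hxi i) (by positivity), hPx⟩

/-- The eigenvalue of a positive eigenvector of a non-negative matrix is the spectral radius. -/
theorem Matrix.spectralRadius_eq_of_pos_eigenvector [Nonempty n] {P : Matrix n n ℝ}
    (hP : ∀ i j, 0 ≤ P i j) {r : ℝ} {x : n → ℝ} (hx : ∀ i, 0 < x i) (h : P *ᵥ x = r • x) :
    (spectralRadius ℂ (P.map (fun t : ℝ => (t : ℂ)))).toReal = r := by
  have i₀ := Classical.arbitrary n
  have hr : 0 ≤ r := by
    have h1 := Matrix.mulVec_nonneg hP (fun i => (hx i).le) i₀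
    rw [h] at h1
    exact nonneg_of_mul_nonneg_left h1 (hx i₀)
  have hspec : ∀ z : ℂ, z ∈ spectrum ℂ (P.map (fun t : ℝ => (t : ℂ))) ↔
      ∃ w : n → ℂ, w ≠ 0 ∧ (P.map (fun t : ℝ => (t : ℂ))) *ᵥ w = z • w := by
    intro z
    rw [← Matrix.spectrum_toLin', ← Module.End.hasEigenvalue_iff_mem_spectrum]
    constructor
    · intro hz
      obtain ⟨w, hw⟩ := hz.exists_hasEigenvector
      exact ⟨w, hw.2, by simpa using hw.apply_eq_smul⟩
    · rintro ⟨w, hw0, hw⟩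
      refine Module.End.hasEigenvalue_of_hasEigenvector (x := w) ?_
      rw [Module.End.hasEigenvector_iff, Module.End.mem_eigenspace_iff]
      exact ⟨by simpa using hw, hw0⟩
  -- Evaluate $Pw=zw$ at an index where $|w_i|/x_i$ is maximal.
  have hle : ∀ z ∈ spectrum ℂ (P.map (fun t : ℝ => (t : ℂ))), ‖z‖ ≤ r := by
    intro z hz
    obtain ⟨w, hw0, hw⟩ := (hspec z).1 hz
    obtain ⟨i, hi⟩ := Finite.exists_max fun i => ‖w i‖ / x i
    obtain ⟨j, hj⟩ := Function.ne_iff.1 hw0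
    have hM : 0 < ‖w i‖ / x i := lt_of_lt_of_le (div_pos (norm_pos_iff.2 hj) (hx j)) (hi j)
    have h1 : ‖z‖ * ‖w i‖ ≤ ‖w i‖ / x i * (r * x i) := by
      calc ‖z‖ * ‖w i‖ = ‖((P.map (fun t : ℝ => (t : ℂ))) *ᵥ w) i‖ := by rw [hw]; simp
        _ ≤ ∑ j, ‖(P i j : ℂ) * w j‖ := norm_sum_le _ _
        _ ≤ ∑ j, ‖w i‖ / x i * (P i j * x j) := by
          refine Finset.sum_le_sum fun j _ => ?_
          rw [norm_mul, Complex.norm_real, Real.norm_of_nonneg (hP i j)]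
          have := mul_le_mul_of_nonneg_left ((div_le_iff₀ (hx j)).1 (hi j)) (hP i j)
          linarith
        _ = ‖w i‖ / x i * (P *ᵥ x) i := by rw [← Finset.mul_sum]; rfl
        _ = _ := by rw [h]; rfl
    have h2 : ‖w i‖ / x i * (r * x i) = r * ‖w i‖ := by
      field_simp [(hx i).ne']
    rw [h2] at h1
    have hwi : 0 < ‖w i‖ := by
      have := mul_pos hM (hx i)
      rwa [div_mul_cancel₀ _ (hx i).ne'] at this
    exact le_of_mul_le_mul_right h1 hwi
  have hr_mem : (r : ℂ) ∈ spectrum ℂ (P.map (fun t : ℝ => (t : ℂ))) := by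
    refine (hspec r).2 ⟨fun i => (x i : ℂ), fun h0 => ?_, ?_⟩
    · have := congrFun h0 i₀
      simp only [Pi.zero_apply, Complex.ofReal_eq_zero] at this
      exact (hx i₀).ne' this
    · ext i
      have := congrFun h i
      simp only [Matrix.mulVec, dotProduct, Pi.smul_apply, smul_eq_mul, Matrix.map_apply] at this ⊢
      rw [← Complex.ofReal_mul, ← this]
      push_cast
      rfl
  have heq : spectralRadius ℂ (P.map (fun t : ℝ => (t : ℂ))) = ENNReal.ofReal r := by
    refine le_antisymm (iSup₂_le fun z hz => ?_) ?_
    · rw [ENNReal.ofReal, ENNReal.coe_le_coe]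
      exact (Real.le_toNNReal_iff_coe_le hr).2 (hle z hz)
    · refine le_trans ?_ (le_iSup₂ (f := fun (k : ℂ) (_ : k ∈ spectrum ℂ _) => (‖k‖₊ : ENNReal))
        (r : ℂ) hr_mem)
      rw [ENNReal.ofReal, ENNReal.coe_le_coe]
      refine Real.toNNReal_le_iff_le_coe.2 ?_
      simp [abs_of_nonneg hr]
  rw [heq, ENNReal.toReal_ofReal hr]

/-- A primitive matrix has a positive left eigenvector. -/
theorem Matrix.IsPrimitive.exists_pos_left_eigenvector [Nonempty n] {P : Matrix n n ℝ}
    (hP : P.IsPrimitive) {r : ℝ} {x : n → ℝ} (hx : ∀ i, 0 < x i) (h : P *ᵥ x = r • x) :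
    ∃ y : n → ℝ, (∀ i, 0 < y i) ∧ y ᵥ* P = r • y := by
  have hPt : Pᵀ.IsPrimitive := by
    obtain ⟨h0, k, hk, hpos⟩ := hP
    exact ⟨fun i j => h0 j i, k, hk, fun i j => by rw [← Matrix.transpose_pow]; exact hpos j i⟩
  obtain ⟨r', -, y, hy, hyr⟩ := hPt.exists_pos_eigenvector
  rw [Matrix.mulVec_transpose] at hyr
  -- Evaluating $y^TPx$ in two ways forces the left and right eigenvalues to agree, because $y\cdot
  -- x>0$.
  have h1 : r' * (y ⬝ᵥ x) = r * (y ⬝ᵥ x) := by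
    have := Matrix.dotProduct_mulVec y P x
    rw [hyr, h, dotProduct_smul, smul_dotProduct] at this
    simpa using this.symm
  have h2 : 0 < y ⬝ᵥ x :=
    Finset.sum_pos (fun i _ => mul_pos (hy i) (hx i)) Finset.univ_nonempty
  exact ⟨y, hy, by rw [hyr, mul_right_cancel₀ h2.ne' h1]⟩

/-- A non-negative backward orbit of a matrix with a positive power and a positive fixed vector
consists of multiples of that vector. -/
theorem Matrix.backward_orbit_of_fixed [Nonempty n] {Q : Matrix n n ℝ} (hQ : ∀ i j, 0 ≤ Q i j)
    {m : ℕ} (hm : ∀ i j, 0 < (Q ^ m) i j) {x : n → ℝ} (hx : ∀ i, 0 < x i) (h : Q *ᵥ x = x)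
    {z : ℕ → n → ℝ} (hz : ∀ k, 0 ≤ z k) (hstep : ∀ k, Q *ᵥ z (k + 1) = z k) :
    ∃ c : ℝ, 0 ≤ c ∧ z 0 = c • x := by
  have hfix : ∀ k, (Q ^ k) *ᵥ x = x := fun k => by
    simpa using Matrix.pow_mulVec_of_eigen (t := 1) (by simpa using h) k
  -- This choice of $\delta$ gives a Harnack-type bound `key`: a large coordinate of $w\ge 0$ makes
  -- $Q^mw$ large everywhere relative to $x$.
  obtain ⟨⟨a, b⟩, hab⟩ := Finite.exists_min fun p : n × n => (Q ^ m) p.1 p.2 / x p.1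
  set δ := (Q ^ m) a b / x a with hδdef
  have hδ : 0 < δ := div_pos (hm _ _) (hx _)
  have key : ∀ w : n → ℝ, 0 ≤ w → ∀ i j, δ * x i * w j ≤ ((Q ^ m) *ᵥ w) i := by
    intro w hw i j
    have h1 : δ * x i ≤ (Q ^ m) i j := (le_div_iff₀ (hx i)).1 (hab (i, j))
    refine (mul_le_mul_of_nonneg_right h1 (hw j)).trans ?_
    exact Finset.single_le_sum (f := fun j => (Q ^ m) i j * w j)
      (fun j _ => mul_nonneg (hm i j).le (hw j)) (Finset.mem_univ j)
  have i₀ := Classical.arbitrary n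
  have hbdd : ∀ k j, z (k + m) j ≤ z 0 i₀ / (δ * x i₀) := by
    intro k j
    have h1 : (δ * z (k + m) j) • x ≤ z k := by
      intro i
      have := key (z (k + m)) (hz _) i j
      rw [Matrix.pow_mulVec_backward hstep] at this
      simp only [Pi.smul_apply, smul_eq_mul]
      linarith
    have h2 := Matrix.mulVec_mono_of_nonneg (Matrix.pow_nonneg_entries hQ k) h1 i₀
    have h3 := Matrix.pow_mulVec_backward hstep k 0
    rw [zero_add] at h3
    rw [h3, Matrix.mulVec_smul, hfix] at h2
    rw [le_div_iff₀ (mul_pos hδ (hx _))]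
    simp only [Pi.smul_apply, smul_eq_mul] at h2
    linarith
  -- $M$ is the least multiple of $x$ above the orbit. The indices start at $m$ because the bound
  -- above controls only $z_{k+m}$.
  let S : Set ℝ := Set.range fun p : ℕ × n => z (p.1 + m) p.2 / x p.2
  obtain ⟨i₁, hi₁⟩ := Finite.exists_min x
  have hSb : BddAbove S := by
    refine ⟨z 0 i₀ / (δ * x i₀) / x i₁, ?_⟩
    rintro _ ⟨⟨k, j⟩, rfl⟩
    exact div_le_div₀ (div_nonneg (hz 0 i₀) (mul_pos hδ (hx _)).le) (hbdd k j) (hx _) (hi₁ j)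
  have hSne : S.Nonempty := ⟨_, ⟨(0, i₀), rfl⟩⟩
  set M := sSup S with hM
  have hle : ∀ k, z (k + m) ≤ M • x := fun k j =>
    (div_le_iff₀ (hx j)).1 (le_csSup hSb ⟨(k, j), rfl⟩)
  have hM0 : 0 ≤ M := le_csSup_of_le hSb ⟨(0, i₀), rfl⟩ (div_nonneg (hz _ _) (hx _).le)
  have hz0 : z 0 ≤ M • x := by
    have := Matrix.mulVec_mono_of_nonneg (Matrix.pow_nonneg_entries hQ m) (hle 0)
    rwa [Matrix.pow_mulVec_backward hstep, Matrix.mulVec_smul, hfix] at this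
  refine ⟨M, hM0, le_antisymm hz0 fun i => ?_⟩
  refine le_of_forall_pos_le_add fun ε hε => ?_
  -- Where $z_{k+m}$ nearly attains $M$, the non-negative orbit $Mx-z$ is small at one coordinate.
  -- By `key` it is then small at every coordinate $m$ steps further back, and pushing forward to
  -- time 0 keeps it below $(\varepsilon/x_i)x$. The value of `η` absorbs the loss $\delta$ and the
  -- smallest coordinate of $x$.
  set η := ε / x i * (δ * x i₁) with hη
  have hηpos : 0 < η := mul_pos (div_pos hε (hx _)) (mul_pos hδ (hx _))
  obtain ⟨_, ⟨⟨k, l⟩, rfl⟩, hkl⟩ := exists_lt_of_lt_csSup hSne (sub_lt_self M hηpos)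
  simp only at hkl
  rw [lt_div_iff₀ (hx l)] at hkl
  have h1 : M • x - z (k + m + m) ≤ (ε / x i) • x := by
    intro j
    have h2 := key (M • x - z (k + m + m)) (sub_nonneg.2 (hle (k + m))) l j
    rw [Matrix.mulVec_sub, Matrix.mulVec_smul, hfix, Matrix.pow_mulVec_backward hstep] at h2
    simp only [Pi.sub_apply, Pi.smul_apply, smul_eq_mul] at h2 ⊢
    have h3 : δ * x l * (M * x j - z (k + m + m) j) ≤ δ * x l * (ε / x i * x i₁) := by
      rw [hη] at hkl
      linarith
    exact (le_of_mul_le_mul_left h3 (mul_pos hδ (hx l))).trans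
      (mul_le_mul_of_nonneg_left (hi₁ j) (div_pos hε (hx _)).le)
  have h4 := Matrix.mulVec_mono_of_nonneg (Matrix.pow_nonneg_entries hQ (k + m + m)) h1 i
  have h5 := Matrix.pow_mulVec_backward hstep (k + m + m) 0
  rw [zero_add] at h5
  rw [Matrix.mulVec_sub, Matrix.mulVec_smul, Matrix.mulVec_smul, hfix, h5] at h4
  simp only [Pi.sub_apply, Pi.smul_apply, smul_eq_mul, div_mul_cancel₀ ε (hx i).ne'] at h4 ⊢
  linarith

/-- The non-negative backward orbits of a primitive matrix are generated by its positive
eigenvector. -/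
theorem Matrix.IsPrimitive.backward_orbit [Nonempty n] {P : Matrix n n ℝ} (hP : P.IsPrimitive)
    {r : ℝ} (hr : 0 < r) {x : n → ℝ} (hx : ∀ i, 0 < x i) (h : P *ᵥ x = r • x)
    {y : ℕ → n → ℝ} (hy : ∀ k, 0 ≤ y k) (hstep : ∀ k, P *ᵥ y (k + 1) = y k) :
    ∃ c : ℝ, 0 ≤ c ∧ ∀ k, y k = (c * (r ^ k)⁻¹) • x := by
  obtain ⟨h0, m, -, hm⟩ := hP
  have main : ∀ y : ℕ → n → ℝ, (∀ k, 0 ≤ y k) → (∀ k, P *ᵥ y (k + 1) = y k) →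
      ∃ c : ℝ, 0 ≤ c ∧ y 0 = c • x := by
    intro y hy hstep
    -- Rescaling by $r^{-1}$ turns the eigenvector into a fixed vector and $y_k$ into $r^ky_k$.
    have := Matrix.backward_orbit_of_fixed (Q := r⁻¹ • P) (m := m) (x := x)
      (z := fun k => r ^ k • y k) (fun i j => mul_nonneg (inv_nonneg.2 hr.le) (h0 i j))
      (fun i j => by
        rw [smul_pow]
        exact mul_pos (by positivity) (hm i j)) hx
      (by rw [Matrix.smul_mulVec, h, smul_smul, inv_mul_cancel₀ hr.ne', one_smul])
      (fun k i => mul_nonneg (by positivity) (hy k i))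
      (fun k => by
        rw [Matrix.smul_mulVec, Matrix.mulVec_smul, hstep, smul_smul, pow_succ', ← mul_assoc,
          inv_mul_cancel₀ hr.ne', one_mul])
    simpa using this
  obtain ⟨c, hc, hc0⟩ := main y hy hstep
  refine ⟨c, hc, fun k => ?_⟩
  -- The orbit started at time $k$ has its own constant; applying $P^k$ compares it with $c$.
  obtain ⟨c', -, hck⟩ := main (fun l => y (l + k)) (fun l => hy _)
    (fun l => by rw [add_right_comm]; exact hstep (l + k))
  simp only [zero_add] at hck
  have h1 := Matrix.pow_mulVec_backward hstep k 0
  rw [zero_add, hck, Matrix.mulVec_smul, Matrix.pow_mulVec_of_eigen h, hc0, smul_smul] at h1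
  have i₀ := Classical.arbitrary n
  have h2 : c' * r ^ k * x i₀ = c * x i₀ := congrFun h1 i₀
  have h3 := mul_right_cancel₀ (hx i₀).ne' h2
  rw [hck, ← h3, mul_assoc, mul_inv_cancel₀ (pow_pos hr k).ne', mul_one]

end Perron

/-! ### Communicating classes -/

section Classes

variable {N : ℕ} {A : Matrix (Fin N) (Fin N) ℝ}

/-- The communicating class of a vertex. -/
def classOf (A : Matrix (Fin N) (Fin N) ℝ) (i : Fin N) : ComClass A := Quotient.mk (communicates A) i

noncomputable instance : Fintype (ComClass A) := Fintype.ofFinite _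

theorem classOf_eq_iff {i j : Fin N} :
    classOf A i = classOf A j ↔ VertexAccess A i j ∧ VertexAccess A j i :=
  Quotient.eq (r := communicates A)

theorem classOf_surjective (α : ComClass A) : ∃ i, classOf A i = α :=
  Quotient.exists_rep α

theorem classAccess_classOf {i j : Fin N} :
    ClassAccess A (classOf A i) (classOf A j) ↔ VertexAccess A i j := by
  constructor
  · rintro (h | ⟨⟨i', hi⟩, ⟨j', hj⟩, h⟩)
    · exact (classOf_eq_iff.1 h).1
    · exact ((classOf_eq_iff.1 hi).2.trans h).trans (classOf_eq_iff.1 hj).1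
  · exact fun h => Or.inr ⟨⟨i, rfl⟩, ⟨j, rfl⟩, h⟩

theorem exists_member_access_iff {i j : Fin N} :
    (∃ k : (classOf A j).Members, VertexAccess A i k) ↔ VertexAccess A i j :=
  ⟨fun ⟨k, hk⟩ => hk.trans (classOf_eq_iff.1 k.2).1, fun h => ⟨⟨j, rfl⟩, h⟩⟩

theorem classRadius_nonneg (α : ComClass A) : 0 ≤ classRadius A α := ENNReal.toReal_nonneg

theorem exists_edge_leaving_class {i j : Fin N} (h : VertexAccess A i j)
    (hij : classOf A i ≠ classOf A j) :
    ∃ a b, classOf A a = classOf A i ∧ classOf A b ≠ classOf A i ∧ 0 < A a b ∧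
      VertexAccess A b j := by
  induction h using Relation.ReflTransGen.head_induction_on with
  | refl => exact absurd rfl hij
  | @head a c hac hcj ih =>
    by_cases hc : classOf A c = classOf A a
    · rw [hc] at ih
      exact ih hij
    · exact ⟨a, c, rfl, hc, hac, hcj⟩

/-- A nonempty union of classes contains a class with no arrows to the other ones. -/
theorem exists_final_class {T : Finset (Fin N)} (hT : T.Nonempty) :
    ∃ j ∈ T, ∀ i k, classOf A i = classOf A j → k ∈ T → 0 < A i k →
      classOf A k = classOf A j := by
  classical
  -- A vertex from which the fewest vertices of $T$ can be reached: an arrow to $k\in T$ cannot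
  -- shrink this set, so $k$ leads back.
  obtain ⟨j, hj, hmin⟩ := Finset.exists_min_image T
    (fun j => (T.filter fun k => VertexAccess A j k).card) hT
  refine ⟨j, hj, fun i k hij hk hik => ?_⟩
  have hjk : VertexAccess A j k := (classOf_eq_iff.1 hij).2.trans (Relation.ReflTransGen.single hik)
  have hsub : (T.filter fun l => VertexAccess A k l) ⊆ T.filter fun l => VertexAccess A j l := by
    intro l hl
    rw [Finset.mem_filter] at hl ⊢
    exact ⟨hl.1, hjk.trans hl.2⟩
  have heq := Finset.eq_of_subset_of_card_le hsub (hmin k hk)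
  have : j ∈ T.filter fun l => VertexAccess A k l := by
    rw [heq]
    exact Finset.mem_filter.2 ⟨hj, Relation.ReflTransGen.refl⟩
  exact classOf_eq_iff.2 ⟨(Finset.mem_filter.1 this).2, hjk⟩

theorem sum_eq_sum_members {α : ComClass A} {f : Fin N → ℝ} (hf : ∀ j, classOf A j ≠ α → f j = 0) :
    ∑ j, f j = ∑ j : α.Members, f j := by
  classical
  rw [← Finset.sum_subset (Finset.filter_subset (fun j => classOf A j = α) Finset.univ)
    (fun j _ hj => hf j fun h => hj (Finset.mem_filter.2 ⟨Finset.mem_univ _, h⟩))]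
  exact Finset.sum_subtype _ 
    (fun j => ⟨fun h => (Finset.mem_filter.1 h).2,
      fun h => Finset.mem_filter.2 ⟨Finset.mem_univ _, h⟩⟩) _

end Classes

/-! ### Backward orbits and the core -/

section Core

variable {N : ℕ} {A : Matrix (Fin N) (Fin N) ℝ}

/-- A non-negative backward orbit of `A`. -/
def IsBackwardOrbit (A : Matrix (Fin N) (Fin N) ℝ) (y : ℕ → Fin N → ℝ) : Prop :=
  (∀ k, 0 ≤ y k) ∧ ∀ k, A *ᵥ y (k + 1) = y k

namespace IsBackwardOrbit

theorem mem_core {y : ℕ → Fin N → ℝ} (hy : IsBackwardOrbit A y) (l : ℕ) : y l ∈ matrixCore A := by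
  simp only [matrixCore, Set.mem_iInter]
  exact fun k _ => ⟨y (l + k), hy.1 _, Matrix.pow_mulVec_backward hy.2 k l⟩

theorem of_eigenvector {x : Fin N → ℝ} (hx : 0 ≤ x) {r : ℝ} (hr : 0 < r) (h : A *ᵥ x = r • x) :
    IsBackwardOrbit A fun k => (r ^ k)⁻¹ • x := by
  refine ⟨fun k i => mul_nonneg (by positivity) (hx i), fun k => ?_⟩
  rw [Matrix.mulVec_smul, h, smul_smul]
  congr 1
  rw [pow_succ, mul_inv, mul_assoc, inv_mul_cancel₀ hr.ne', mul_one]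

theorem linear_comb {y z : ℕ → Fin N → ℝ} (hy : IsBackwardOrbit A y) (hz : IsBackwardOrbit A z)
    {a b : ℝ} (ha : 0 ≤ a) (hb : 0 ≤ b) : IsBackwardOrbit A fun k => a • y k + b • z k := by
  refine ⟨fun k => add_nonneg (smul_nonneg ha (hy.1 k)) (smul_nonneg hb (hz.1 k)), fun k => ?_⟩
  rw [Matrix.mulVec_add, Matrix.mulVec_smul, Matrix.mulVec_smul, hy.2, hz.2]

end IsBackwardOrbit

/-- Fitting decomposition: the ranges of $A^k$ stabilize at a subspace complementary to the union of
the kernels, so $A$ is injective there. -/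
theorem exists_range_pow_stable (A : Matrix (Fin N) (Fin N) ℝ) :
    ∃ W : Submodule ℝ (Fin N → ℝ), ∃ m : ℕ,
      (∀ k, m ≤ k → ∀ x, x ∈ W ↔ ∃ y, (A ^ k) *ᵥ y = x) ∧
      ∀ x ∈ W, ∀ y ∈ W, A *ᵥ x = A *ᵥ y → x = y := by
  have hpow : ∀ k x, ((Matrix.mulVecLin A) ^ k) x = (A ^ k) *ᵥ x := by
    intro k x
    rw [← Matrix.toLin'_apply', ← Matrix.toLin'_pow, Matrix.toLin'_apply]
  obtain ⟨m, hm⟩ := Filter.eventually_atTop.1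
    (LinearMap.eventually_iInf_range_pow_eq (Matrix.mulVecLin A))
  refine ⟨⨅ k, LinearMap.range ((Matrix.mulVecLin A) ^ k), m, fun k hk x => ?_, ?_⟩
  · rw [hm k hk, LinearMap.mem_range]
    simp only [hpow]
  · intro x hx y hy hxy
    have hdis := (LinearMap.isCompl_iSup_ker_pow_iInf_range_pow (Matrix.mulVecLin A)).disjoint
    have h1 : x - y ∈ ⨆ k, LinearMap.ker ((Matrix.mulVecLin A) ^ k) := by
      refine Submodule.mem_iSup_of_mem 1 ?_
      rw [LinearMap.mem_ker, hpow, pow_one, Matrix.mulVec_sub, hxy, sub_self]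
    exact sub_eq_zero.1 (Submodule.disjoint_def.1 hdis _ h1 (Submodule.sub_mem _ hx hy))

theorem matrixCore_nonneg (hA : ∀ i j, 0 ≤ A i j) {x : Fin N → ℝ} (hx : x ∈ matrixCore A) :
    0 ≤ x := by
  simp only [matrixCore, Set.mem_iInter] at hx
  obtain ⟨y, hy, rfl⟩ := hx 1 le_rfl
  exact Matrix.mulVec_nonneg (Matrix.pow_nonneg_entries hA 1) hy

theorem matrixCore_mem_range {x : Fin N → ℝ} (hx : x ∈ matrixCore A) (k : ℕ) :
    ∃ y, (A ^ k) *ᵥ y = x := by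
  rcases k.eq_zero_or_pos with rfl | hk
  · exact ⟨x, by simp⟩
  · simp only [matrixCore, Set.mem_iInter] at hx
    obtain ⟨y, -, h⟩ := hx k hk
    exact ⟨y, h⟩

theorem matrixCore_injOn {x y : Fin N → ℝ} (hx : x ∈ matrixCore A) (hy : y ∈ matrixCore A)
    (h : A *ᵥ x = A *ᵥ y) : x = y := by
  obtain ⟨W, m, hW, hinj⟩ := exists_range_pow_stable A
  exact hinj x ((hW m le_rfl x).2 (matrixCore_mem_range hx m)) y
    ((hW m le_rfl y).2 (matrixCore_mem_range hy m)) h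

/-- The candidate is the unique preimage of $x$ in the stable range. The definition of the core
gives a non-negative $z$ with $A^{k+m+1}z=x$ for each $k$; by uniqueness $A^{k+m}z$ is always this
same preimage, which therefore lies in the core. -/
theorem matrixCore_exists_preimage (hA : ∀ i j, 0 ≤ A i j) {x : Fin N → ℝ}
    (hx : x ∈ matrixCore A) : ∃ y ∈ matrixCore A, A *ᵥ y = x := by
  obtain ⟨W, m, hW, hinj⟩ := exists_range_pow_stable A
  obtain ⟨y₀, hy₀⟩ := matrixCore_mem_range hx (m + 1)
  rw [← Matrix.pow_mulVec_succ] at hy₀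
  have hyW := (hW m le_rfl ((A ^ m) *ᵥ y₀)).2 ⟨y₀, rfl⟩
  refine ⟨(A ^ m) *ᵥ y₀, ?_, hy₀⟩
  simp only [matrixCore, Set.mem_iInter]
  intro k hk
  simp only [matrixCore, Set.mem_iInter] at hx
  obtain ⟨z, hz, hzx⟩ := hx (k + m + 1) (by omega)
  simp only at hzx
  rw [← Matrix.pow_mulVec_succ] at hzx
  have := hinj _ hyW _ ((hW (k + m) (by omega) _).2 ⟨z, rfl⟩) (hy₀.trans hzx.symm)
  refine ⟨(A ^ m) *ᵥ z, Matrix.mulVec_nonneg (Matrix.pow_nonneg_entries hA m) hz, ?_⟩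
  simp only
  rw [this, Matrix.mulVec_mulVec, pow_add]

/-- Together with `IsBackwardOrbit.unique` this identifies core vectors with backward orbits, so
that an infinite sequence of level weights is encoded by its first term. -/
theorem exists_backwardOrbit (hA : ∀ i j, 0 ≤ A i j) {x : Fin N → ℝ} (hx : x ∈ matrixCore A) :
    ∃ y, IsBackwardOrbit A y ∧ y 0 = x := by
  choose f hf hfx using fun x : matrixCore A => matrixCore_exists_preimage hA x.2
  let g : ℕ → matrixCore A := fun k => Nat.rec ⟨x, hx⟩ (fun _ z => ⟨f z, hf z⟩) k
  have hg : IsBackwardOrbit A fun k => (g k).1 :=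
    ⟨fun k => matrixCore_nonneg hA (g k).2, fun k => hfx (g k)⟩
  exact ⟨_, hg, rfl⟩

theorem IsBackwardOrbit.unique {y z : ℕ → Fin N → ℝ} (hy : IsBackwardOrbit A y)
    (hz : IsBackwardOrbit A z) (h : y 0 = z 0) (k : ℕ) : y k = z k := by
  induction k with
  | zero => exact h
  | succ k ih => exact matrixCore_injOn (hy.mem_core _) (hz.mem_core _) (by rw [hy.2, hz.2, ih])

theorem matrixCore_isConvexCone (hA : ∀ i j, 0 ≤ A i j) : IsConvexCone (matrixCore A) := by
  intro x hx y hy a b ha hb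
  obtain ⟨x', hx', rfl⟩ := exists_backwardOrbit hA hx
  obtain ⟨y', hy', rfl⟩ := exists_backwardOrbit hA hy
  exact (hx'.linear_comb hy' ha hb).mem_core 0

theorem zero_mem_matrixCore : (0 : Fin N → ℝ) ∈ matrixCore A := by
  simp only [matrixCore, Set.mem_iInter]
  exact fun k _ => ⟨0, le_refl (0 : Fin N → ℝ), Matrix.mulVec_zero _⟩

theorem sum_mem_matrixCore (hA : ∀ i j, 0 ≤ A i j) {ι : Type*} (s : Finset ι) {f : ι → Fin N → ℝ}
    (hf : ∀ i ∈ s, f i ∈ matrixCore A) : ∑ i ∈ s, f i ∈ matrixCore A := by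
  classical
  induction s using Finset.induction_on with
  | empty => exact zero_mem_matrixCore
  | insert a s ha ih =>
    rw [Finset.sum_insert ha]
    have := matrixCore_isConvexCone hA _ (hf a (Finset.mem_insert_self _ _)) _
      (ih fun i hi => hf i (Finset.mem_insert_of_mem hi)) 1 1 zero_le_one zero_le_one
    simpa using this

/-- Every face containing $x$ contains its summands; conversely, the condition on summands makes the
ray itself a face. -/
theorem isExtremeVector_iff {C : Set (Fin N → ℝ)} (hC : IsConvexCone C) (hpos : ∀ x ∈ C, 0 ≤ x)
    {x : Fin N → ℝ} : IsExtremeVector C x ↔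
      x ∈ C ∧ x ≠ 0 ∧ ∀ y ∈ C, x - y ∈ C → y ∈ rayOf x := by
  refine and_congr_right fun hx => and_congr_right fun _ => ⟨fun h y hy hxy => ?_, fun h => ?_⟩
  · rw [← h]
    exact fun Q hQ => hQ.1.2.2 x hQ.2 y hy hxy
  · refine Set.Subset.antisymm (fun y hy => ?_) ?_
    · refine hy _ ⟨⟨?_, ?_, ?_⟩, 1, zero_le_one, (one_smul ℝ x).symm⟩
      · rintro _ ⟨a, ha, rfl⟩
        simpa using hC x hx x hx a 0 ha le_rfl
      · rintro _ ⟨c, hc, rfl⟩ _ ⟨d, hd, rfl⟩ a b ha hb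
        exact ⟨a * c + b * d, by positivity, by rw [smul_smul, smul_smul, add_smul]⟩
      · rintro _ ⟨t, ht, rfl⟩ z hz hxz
        rcases ht.eq_or_lt with rfl | ht
        -- The ray also contains 0, whose only decomposition is trivial because the cone lies in the
        -- orthant.
        · have h1 := hpos _ hz
          have h2 := hpos _ hxz
          rw [zero_smul, zero_sub] at h2
          exact ⟨0, le_rfl, by rw [zero_smul]; exact le_antisymm (neg_nonneg.1 h2) h1⟩
        · have h1 := hC z hz z hz t⁻¹ 0 (inv_nonneg.2 ht.le) le_rfl
          have h2 := hC _ hxz _ hxz t⁻¹ 0 (inv_nonneg.2 ht.le) le_rfl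
          rw [zero_smul, add_zero] at h1 h2
          rw [smul_sub, smul_smul, inv_mul_cancel₀ ht.ne', one_smul] at h2
          obtain ⟨a, ha, haz⟩ := h _ h1 h2
          refine ⟨t * a, by positivity, ?_⟩
          rw [← smul_smul, ← haz, smul_smul, mul_inv_cancel₀ ht.ne', one_smul]
    · rintro _ ⟨a, ha, rfl⟩ Q hQ
      simpa using hQ.1.2.1 x hQ.2 x hQ.2 a 0 ha le_rfl

end Core

/-! ### Perron vectors of the classes -/

section ClassVectors

variable {N : ℕ} {A : Matrix (Fin N) (Fin N) ℝ}

/-- `u` is supported on the class `α` and restricts to a positive eigenvector of its block. -/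
structure IsClassVector (A : Matrix (Fin N) (Fin N) ℝ) (α : ComClass A) (u : Fin N → ℝ) : Prop where
  nonneg : 0 ≤ u
  pos_iff : ∀ i, 0 < u i ↔ classOf A i = α
  eigen : ∀ i, classOf A i = α → (A *ᵥ u) i = classRadius A α * u i

theorem IsClassVector.eq_zero {α : ComClass A} {u : Fin N → ℝ} (hu : IsClassVector A α u) {i : Fin N}
    (hi : classOf A i ≠ α) : u i = 0 :=
  le_antisymm (not_lt.1 fun h => hi ((hu.pos_iff i).1 h)) (hu.nonneg i)

instance (α : ComClass A) : Nonempty α.Members :=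
  let ⟨i, hi⟩ := classOf_surjective α
  ⟨⟨i, hi⟩⟩

theorem classRadius_eq_zero {α : ComClass A} (h : diagBlock A α = 0) : classRadius A α = 0 := by
  have : (diagBlock A α).map (fun t : ℝ => (t : ℂ)) = 0 := by
    rw [h]
    ext
    simp
  rw [classRadius, this, spectralRadius]
  simp

/-- The extension by zero of a vector on a class. -/
noncomputable def extendClass (α : ComClass A) (u : α.Members → ℝ) : Fin N → ℝ := fun i =>
  open Classical in if h : classOf A i = α then u ⟨i, h⟩ else 0

theorem extendClass_apply {α : ComClass A} (u : α.Members → ℝ) (i : α.Members) :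
    extendClass α u i = u i := by
  have : classOf A i = α := i.2
  simp [extendClass, this]

theorem extendClass_eq_zero {α : ComClass A} (u : α.Members → ℝ) {i : Fin N}
    (hi : classOf A i ≠ α) : extendClass α u i = 0 := by
  simp [extendClass, hi]

theorem diagBlock_mulVec {α : ComClass A} {y : Fin N → ℝ} (i : α.Members)
    (h : ∀ j, classOf A j ≠ α → A i j * y j = 0) :
    (diagBlock A α *ᵥ fun j => y j) i = (A *ᵥ y) i := by
  simp only [Matrix.mulVec, dotProduct]
  rw [sum_eq_sum_members h]
  rfl

theorem diagBlock_nonneg (hA : ∀ i j, 0 ≤ A i j) (α : ComClass A) (i j : α.Members) :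
    0 ≤ diagBlock A α i j :=
  hA i j

theorem isClassVector_extendClass {α : ComClass A} {u : α.Members → ℝ} (hu : ∀ i, 0 < u i)
    (h : diagBlock A α *ᵥ u = classRadius A α • u) : IsClassVector A α (extendClass α u) where
  nonneg i := by
    by_cases hi : classOf A i = α
    · exact (hu ⟨i, hi⟩).le.trans_eq (extendClass_apply u ⟨i, hi⟩).symm
    · exact (extendClass_eq_zero u hi).ge
  pos_iff i := by
    by_cases hi : classOf A i = α
    · have := extendClass_apply u ⟨i, hi⟩
      simp only at this
      simp [hi, this, hu]
    · simp [hi, extendClass_eq_zero u hi]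
  eigen i hi := by
    have h1 := diagBlock_mulVec (y := extendClass α u) ⟨i, hi⟩
      (fun j hj => by rw [extendClass_eq_zero u hj, mul_zero])
    have h2 := extendClass_apply u ⟨i, hi⟩
    simp only [extendClass_apply] at h1
    simp only at h2
    rw [← h1, h, h2]
    rfl

/-- The Perron–Frobenius facts about the block of a class, in terms of the whole matrix. -/
theorem exists_isClassVector (hA : ∀ i j, 0 ≤ A i j) (hprim : HasPrimitiveBlocks A)
    (α : ComClass A) : ∃ u, IsClassVector A α u ∧
      (∀ y, IsBackwardOrbit A y →
        (∀ k i j, classOf A i = α → classOf A j ≠ α → A i j * y (k + 1) j = 0) →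
        ∃ c, 0 ≤ c ∧ (classRadius A α = 0 → c = 0) ∧
          ∀ k i, classOf A i = α → y k i = c * (classRadius A α ^ k)⁻¹ * u i) := by
  have hrestr : ∀ y, IsBackwardOrbit A y →
      (∀ k i j, classOf A i = α → classOf A j ≠ α → A i j * y (k + 1) j = 0) →
      ∀ k, diagBlock A α *ᵥ (fun j => y (k + 1) j) = fun j : α.Members => y k j := by
    intro y hy hzero k
    ext i
    rw [diagBlock_mulVec i fun j hj => hzero k i j i.2 hj, hy.2]
  -- A zero block is not covered by primitivity: any positive vector on the class serves as $u$, and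
  -- the block annihilates the restricted orbit, so $c=0$. The clause `classRadius A α = 0 → c = 0`
  -- records this for later divisions by the radius.
  by_cases h0 : diagBlock A α = 0
  · have hr := classRadius_eq_zero h0
    refine ⟨_, isClassVector_extendClass (u := fun _ => 1) (fun _ => one_pos) ?_, ?_⟩
    · rw [h0, hr, Matrix.zero_mulVec, zero_smul]
    · intro y hy hzero
      refine ⟨0, le_rfl, fun _ => rfl, fun k i hi => ?_⟩
      have := congrFun (hrestr y hy hzero k) ⟨i, hi⟩
      rw [h0, Matrix.zero_mulVec] at this
      simpa using this.symm
  · have hP := hprim α h0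
    obtain ⟨r, hr, u, hu, hur⟩ := hP.exists_pos_eigenvector
    have hrad : classRadius A α = r :=
      Matrix.spectralRadius_eq_of_pos_eigenvector (diagBlock_nonneg hA _) hu hur
    refine ⟨_, isClassVector_extendClass hu (by rw [hur, hrad]), ?_⟩
    intro y hy hzero
    obtain ⟨c, hc, hcy⟩ := hP.backward_orbit hr hu hur (y := fun k (j : α.Members) => y k j)
      (fun k i => hy.1 k i) (hrestr y hy hzero)
    refine ⟨c, hc, fun h => absurd (hrad.symm.trans h) hr.ne', fun k i hi => ?_⟩
    have h1 := congrFun (hcy k) ⟨i, hi⟩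
    have h2 := extendClass_apply u ⟨i, hi⟩
    simp only at h1 h2
    rw [h1, h2, hrad]
    rfl

/-- An arrow inside the class makes its block nonzero, hence primitive, and a primitive block has a
positive Perron eigenvalue. -/
theorem classRadius_pos (hA : ∀ i j, 0 ≤ A i j) (hprim : HasPrimitiveBlocks A) {i j : Fin N}
    (hij : classOf A i = classOf A j) (h : 0 < A i j) : 0 < classRadius A (classOf A j) := by
  have h0 : diagBlock A (classOf A j) ≠ 0 := fun h0 => by
    have := congrFun (congrFun h0 ⟨i, hij⟩) ⟨j, rfl⟩
    exact h.ne' this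
  obtain ⟨r, hr, u, hu, hur⟩ := (hprim _ h0).exists_pos_eigenvector
  have hrad : classRadius A (classOf A j) = r :=
    Matrix.spectralRadius_eq_of_pos_eigenvector (diagBlock_nonneg hA _) hu hur
  rwa [hrad]

/-- A class has radius less than `r` if `A x ≤ r x` on it for a positive `x`, with a contribution
to `A x` from outside of the class. -/
theorem classRadius_lt (hA : ∀ i j, 0 ≤ A i j) (hprim : HasPrimitiveBlocks A) {α : ComClass A}
    {x : Fin N → ℝ} (hx : 0 ≤ x) (hpos : ∀ i, classOf A i = α → 0 < x i) {r : ℝ}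
    (hle : ∀ i, classOf A i = α → (A *ᵥ x) i ≤ r * x i) {a b : Fin N} (ha : classOf A a = α)
    (hb : classOf A b ≠ α) (hab : 0 < A a b) (hxb : 0 < x b) : classRadius A α < r := by
  set x' : α.Members → ℝ := fun j => x j with hx'
  have hsum : ∀ i : α.Members, (diagBlock A α *ᵥ x') i = (A *ᵥ extendClass α x') i := by
    intro i
    rw [← diagBlock_mulVec i fun j hj => by rw [extendClass_eq_zero x' hj, mul_zero]]
    simp only [extendClass_apply]
  have hext : extendClass α x' ≤ x := by
    intro i
    by_cases hi : classOf A i = α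
    · exact (extendClass_apply x' ⟨i, hi⟩).le
    · rw [extendClass_eq_zero x' hi]
      exact hx i
  have hble : ∀ i : α.Members, (diagBlock A α *ᵥ x') i ≤ r * x' i := fun i => by
    rw [hsum]
    exact (Matrix.mulVec_mono_of_nonneg hA hext i).trans (hle i i.2)
  have hblt : (diagBlock A α *ᵥ x') ⟨a, ha⟩ < r * x' ⟨a, ha⟩ := by
    rw [hsum]
    refine lt_of_lt_of_le ?_ (hle a ha)
    refine Finset.sum_lt_sum (fun j _ => mul_le_mul_of_nonneg_left (hext j) (hA a j))
      ⟨b, Finset.mem_univ b, ?_⟩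
    rw [extendClass_eq_zero x' hb, mul_zero]
    exact mul_pos hab hxb
  by_cases h0 : diagBlock A α = 0
  · rw [classRadius_eq_zero h0]
    rw [h0, Matrix.zero_mulVec] at hblt
    exact pos_of_mul_pos_left hblt (hpos a ha).le
  · have hP := hprim α h0
    obtain ⟨s, hs, u, hu, hus⟩ := hP.exists_pos_eigenvector
    have hrad : classRadius A α = s :=
      Matrix.spectralRadius_eq_of_pos_eigenvector (diagBlock_nonneg hA _) hu hus
    -- Pairing with a positive left eigenvector turns a single strict coordinate into a strict
    -- inequality between $s$ and $r$.
    obtain ⟨v, hv, hvs⟩ := hP.exists_pos_left_eigenvector hu hus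
    have h1 : s * (v ⬝ᵥ x') < r * (v ⬝ᵥ x') := by
      have h2 := Matrix.dotProduct_mulVec v (diagBlock A α) x'
      rw [hvs, smul_dotProduct, smul_eq_mul] at h2
      rw [← h2, ← smul_eq_mul r, ← dotProduct_smul]
      exact Finset.sum_lt_sum (fun i _ => mul_le_mul_of_nonneg_left (hble i) (hv i).le)
        ⟨⟨a, ha⟩, Finset.mem_univ _, mul_lt_mul_of_pos_left hblt (hv _)⟩
    have h3 : 0 < v ⬝ᵥ x' :=
      Finset.sum_pos (fun i _ => mul_pos (hv i) (hpos i i.2)) Finset.univ_nonempty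
    rw [hrad]
    exact lt_of_mul_lt_mul_right h1 h3.le

end ClassVectors

/-! ### Distinguished eigenvectors -/

section Distinguished

variable {N : ℕ} {A : Matrix (Fin N) (Fin N) ℝ}

theorem mulVec_apply_eq_zero {x : Fin N → ℝ} (hA : ∀ i j, 0 ≤ A i j) {i : Fin N}
    (h : ∀ j, 0 < A i j → x j = 0) : (A *ᵥ x) i = 0 := by
  rw [Matrix.mulVec, dotProduct]
  refine Finset.sum_eq_zero fun j _ => ?_
  rcases (hA i j).eq_or_lt with h0 | h0
  · rw [← h0, zero_mul]
  · rw [h j h0, mul_zero]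

theorem mulVec_apply_pos (hA : ∀ i j, 0 ≤ A i j) {x : Fin N → ℝ} (hx : 0 ≤ x) {i j : Fin N}
    (hij : 0 < A i j) (hj : 0 < x j) : 0 < (A *ᵥ x) i :=
  Finset.sum_pos' (fun k _ => mul_nonneg (hA i k) (hx k)) ⟨j, Finset.mem_univ j, mul_pos hij hj⟩

/-- On a union of classes of radius less than `r` there is a positive vector that `A` contracts
below `r`. -/
theorem exists_strict_supersolution (hA : ∀ i j, 0 ≤ A i j) (hprim : HasPrimitiveBlocks A) {r : ℝ}
    (T : Finset (Fin N)) (hsat : ∀ i ∈ T, ∀ j, classOf A i = classOf A j → j ∈ T)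
    (hr : ∀ i ∈ T, classRadius A (classOf A i) < r) :
    ∃ w : Fin N → ℝ, 0 ≤ w ∧ (∀ i, 0 < w i ↔ i ∈ T) ∧ ∀ i ∈ T, (A *ᵥ w) i < r * w i := by
  classical
  induction T using Finset.strongInduction with
  | H T ih =>
    rcases T.eq_empty_or_nonempty with rfl | hne
    · exact ⟨0, le_rfl, by simp, by simp⟩
    -- Peel off a final class. The vector $w$ built on the rest does not contribute to $Aw$ on that
    -- class, where the Perron vector $u$ is already contracted strictly.
    obtain ⟨j, hj, hfinal⟩ := exists_final_class (A := A) hne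
    obtain ⟨u, hu, -⟩ := exists_isClassVector hA hprim (classOf A j)
    set T' := T.filter fun i => classOf A i ≠ classOf A j with hT'
    have hmem : ∀ i, i ∈ T' ↔ i ∈ T ∧ classOf A i ≠ classOf A j := fun i => Finset.mem_filter
    obtain ⟨w, hw, hwT, hws⟩ := ih T'
      ⟨Finset.filter_subset _ _, fun h => ((hmem j).1 (h hj)).2 rfl⟩
      (fun i hi k hik => (hmem k).2
        ⟨hsat i ((hmem i).1 hi).1 k hik, hik ▸ ((hmem i).1 hi).2⟩)
      (fun i hi => hr i ((hmem i).1 hi).1)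
    have hw0 : ∀ i, i ∉ T' → w i = 0 := fun i hi =>
      le_antisymm (not_lt.1 fun h => hi ((hwT i).1 h)) (hw i)
    -- A large multiple of $w$ has enough strict slack to absorb the contribution of $u$ on the
    -- remaining vertices.
    obtain ⟨K, hKpos, hK⟩ : ∃ K : ℝ, 0 < K ∧
        ∀ i ∈ T', (A *ᵥ u) i < K * (r * w i - (A *ᵥ w) i) :=
      ((Filter.eventually_gt_atTop 0).and ((Filter.eventually_all_finset T').2 fun i hi =>
        (Filter.tendsto_id.atTop_mul_const (sub_pos.2 (hws i hi))).eventually_gt_atTop _)).exists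
    refine ⟨K • w + u, add_nonneg (smul_nonneg hKpos.le hw) hu.nonneg, fun i => ?_, fun i hi => ?_⟩
    · simp only [Pi.add_apply, Pi.smul_apply, smul_eq_mul]
      by_cases hij : classOf A i = classOf A j
      · have h1 := (hu.pos_iff i).2 hij
        have h2 := mul_nonneg hKpos.le (hw i)
        exact ⟨fun _ => hsat j hj i hij.symm, fun _ => by linarith⟩
      · rw [hu.eq_zero hij, add_zero]
        constructor
        · intro h
          exact ((hmem i).1 ((hwT i).1 (pos_of_mul_pos_right h hKpos.le))).1
        · exact fun h => mul_pos hKpos ((hwT i).2 ((hmem i).2 ⟨h, hij⟩))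
    · rw [Matrix.mulVec_add, Matrix.mulVec_smul]
      simp only [Pi.add_apply, Pi.smul_apply, smul_eq_mul]
      by_cases hij : classOf A i = classOf A j
      · rw [mulVec_apply_eq_zero (x := w) hA fun k hk => hw0 k fun h =>
            ((hmem k).1 h).2 (hfinal i k hij ((hmem k).1 h).1 hk),
          hw0 i fun h => ((hmem i).1 h).2 hij, hu.eigen i hij, mul_zero, zero_add, zero_add]
        have := hr i hi
        rw [hij] at this
        exact mul_lt_mul_of_pos_right this ((hu.pos_iff i).2 hij)
      · have := hK i ((hmem i).2 ⟨hi, hij⟩)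
        rw [hu.eq_zero hij]
        linarith

/-- The least eigenvector above a subsolution, as the limit of the normalized iterates. -/
theorem exists_least_eigenvector (hA : ∀ i j, 0 ≤ A i j) {r : ℝ} (hr : 0 < r) {u z : Fin N → ℝ}
    (hu : r • u ≤ A *ᵥ u) (hz : ∀ m : ℕ, (r ^ m)⁻¹ • ((A ^ m) *ᵥ u) ≤ z) :
    ∃ x : Fin N → ℝ, A *ᵥ x = r • x ∧ u ≤ x ∧
      ∀ z', (∀ m : ℕ, (r ^ m)⁻¹ • ((A ^ m) *ᵥ u) ≤ z') → x ≤ z' := by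
  set a : ℕ → Fin N → ℝ := fun m => (r ^ m)⁻¹ • ((A ^ m) *ᵥ u) with ha
  have hstep : ∀ m, A *ᵥ a m = r • a (m + 1) := by
    intro m
    simp only [ha]
    rw [Matrix.mulVec_smul, Matrix.pow_mulVec_succ, smul_smul]
    congr 1
    rw [pow_succ', mul_inv, ← mul_assoc, mul_inv_cancel₀ hr.ne', one_mul]
  -- The inequality $ru\le Au$ is preserved by $A^m$, so the normalized iterates increase.
  have hmono : Monotone a := by
    refine monotone_nat_of_le_succ fun m => ?_
    have h1 := Matrix.mulVec_mono_of_nonneg (Matrix.pow_nonneg_entries hA m) hu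
    rw [Matrix.mulVec_smul, Matrix.mulVec_mulVec, ← pow_succ] at h1
    intro i
    have h2 := mul_le_mul_of_nonneg_left (h1 i) (inv_nonneg.2 (pow_pos hr (m + 1)).le)
    simp only [ha, Pi.smul_apply, smul_eq_mul] at h2 ⊢
    refine le_trans (le_of_eq ?_) h2
    rw [pow_succ, mul_inv, mul_assoc, inv_mul_cancel_left₀ hr.ne']
  have hbdd : ∀ i, BddAbove (Set.range fun m => a m i) := fun i =>
    ⟨z i, by rintro _ ⟨m, rfl⟩; exact hz m i⟩
  have hlim : Filter.Tendsto a Filter.atTop (nhds fun i => ⨆ m, a m i) :=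
    tendsto_pi_nhds.2 fun i => tendsto_atTop_ciSup (fun m l h => hmono h i) (hbdd i)
  refine ⟨fun i => ⨆ m, a m i, ?_, fun i => ?_, fun z' hz' i => ciSup_le fun m => hz' m i⟩
  · have hcont : Continuous fun x : Fin N → ℝ => A *ᵥ x := by fun_prop
    have h1 := (hcont.tendsto _).comp hlim
    have h2 := (hlim.comp (Filter.tendsto_add_atTop_nat 1)).const_smul r
    refine tendsto_nhds_unique h1 (h2.congr fun m => ?_)
    exact (hstep m).symm
  · have := le_ciSup (hbdd i) 0
    simpa [ha] using this

theorem pow_mulVec_eq_zero_of_not_access (hA : ∀ i j, 0 ≤ A i j) {j : Fin N} {u : Fin N → ℝ}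
    (hu : ∀ i, ¬ VertexAccess A i j → u i = 0) (m : ℕ) {i : Fin N} (hi : ¬ VertexAccess A i j) :
    ((A ^ m) *ᵥ u) i = 0 := by
  induction m generalizing i with
  | zero => simpa using hu i hi
  | succ m ih =>
    rw [← Matrix.pow_mulVec_succ]
    exact mulVec_apply_eq_zero hA fun k hk => ih fun h =>
      hi (Relation.ReflTransGen.head hk h)

theorem pos_of_access (hA : ∀ i j, 0 ≤ A i j) {r : ℝ} (hr : 0 < r) {x : Fin N → ℝ} (hx : 0 ≤ x)
    (h : A *ᵥ x = r • x) {i j : Fin N} (hij : VertexAccess A i j) (hj : 0 < x j) : 0 < x i := by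
  induction hij using Relation.ReflTransGen.head_induction_on with
  | refl => exact hj
  | @head a c hac _ ih =>
    have := mulVec_apply_pos hA hx hac ih
    rw [h] at this
    exact pos_of_mul_pos_right this hr.le

/-- If the normalized iterates of a class vector are bounded, then the class has a distinguished
eigenvector, which is the least vector above them. -/
theorem exists_distinguishedEigenvector_of_bounded (hA : ∀ i j, 0 ≤ A i j) {α : ComClass A}
    (hr : 0 < classRadius A α) {u z : Fin N → ℝ} (hu : IsClassVector A α u)
    (hz : ∀ m : ℕ, (classRadius A α ^ m)⁻¹ • ((A ^ m) *ᵥ u) ≤ z) :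
    ∃ x, IsDistinguishedEigenvector A α x ∧ u ≤ x ∧
      ∀ z', (∀ m : ℕ, (classRadius A α ^ m)⁻¹ • ((A ^ m) *ᵥ u) ≤ z') → x ≤ z' := by
  classical
  obtain ⟨j, rfl⟩ := classOf_surjective α
  have hsub : classRadius A (classOf A j) • u ≤ A *ᵥ u := by
    intro i
    by_cases hi : classOf A i = classOf A j
    · exact (hu.eigen i hi).ge
    · simp only [Pi.smul_apply, hu.eq_zero hi, smul_zero]
      exact Matrix.mulVec_nonneg hA hu.nonneg i
  obtain ⟨x, hx, hux, hmin⟩ := exists_least_eigenvector hA hr hsub hz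
  have hx0 : 0 ≤ x := hu.nonneg.trans hux
  refine ⟨x, ⟨hx, hx0, fun i => ?_⟩, hux, hmin⟩
  rw [exists_member_access_iff]
  constructor
  · intro hi
    by_contra hacc
    -- Truncating $z$ to the vertices with access to the class still bounds all iterates, so the
    -- least bound vanishes elsewhere.
    have hle := hmin (fun k => if VertexAccess A k j then z k else 0) fun m k => by
      by_cases hk : VertexAccess A k j
      · simpa [hk] using hz m k
      · have hm := pow_mulVec_eq_zero_of_not_access hA (u := u) (j := j)
          (fun i hi => hu.eq_zero fun h => hi (classOf_eq_iff.1 h).1) m hk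
        simp [hk, hm]
    have := hle i
    simp only [hacc, if_false] at this
    linarith
  · exact fun h => pos_of_access hA hr hx0 hx h (((hu.pos_iff j).2 rfl).trans_le (hux j))

/-- The vertices outside $\alpha$ with access to $\alpha$ lie in classes of smaller radius and so
carry a strict supersolution $w$. For large $K$ the vector $z=Kw+u$ satisfies $Az\le\rho_\alpha z$,
whence $A^mu\le\rho_\alpha^mz$. -/
theorem IsDistinguished.exists_bound (hA : ∀ i j, 0 ≤ A i j) (hprim : HasPrimitiveBlocks A)
    {α : ComClass A} (hα : IsDistinguished A α) (hr : 0 < classRadius A α) {u : Fin N → ℝ}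
    (hu : IsClassVector A α u) :
    ∃ z, ∀ m : ℕ, (classRadius A α ^ m)⁻¹ • ((A ^ m) *ᵥ u) ≤ z := by
  classical
  obtain ⟨j, rfl⟩ := classOf_surjective α
  set r := classRadius A (classOf A j)
  set T : Finset (Fin N) :=
    Finset.univ.filter fun i => VertexAccess A i j ∧ classOf A i ≠ classOf A j with hT
  have hmem : ∀ i, i ∈ T ↔ VertexAccess A i j ∧ classOf A i ≠ classOf A j := fun i => by
    rw [hT, Finset.mem_filter]
    exact and_iff_right (Finset.mem_univ i)
  obtain ⟨w, hw, hwT, hws⟩ := exists_strict_supersolution hA hprim (r := r) T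
    (fun i hi k hik => (hmem k).2 ⟨(classOf_eq_iff.1 hik).2.trans ((hmem i).1 hi).1,
      hik ▸ ((hmem i).1 hi).2⟩)
    (fun i hi => hα _ ((hmem i).1 hi).2 (classAccess_classOf.2 ((hmem i).1 hi).1))
  have hw0 : ∀ i, i ∉ T → w i = 0 := fun i hi =>
    le_antisymm (not_lt.1 fun h => hi ((hwT i).1 h)) (hw i)
  obtain ⟨K, hKpos, hK⟩ : ∃ K : ℝ, 0 < K ∧
      ∀ i ∈ T, (A *ᵥ u) i < K * (r * w i - (A *ᵥ w) i) :=
    ((Filter.eventually_gt_atTop 0).and ((Filter.eventually_all_finset T).2 fun i hi =>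
      (Filter.tendsto_id.atTop_mul_const (sub_pos.2 (hws i hi))).eventually_gt_atTop _)).exists
  have hsuper : A *ᵥ (K • w + u) ≤ r • (K • w + u) := by
    intro i
    rw [Matrix.mulVec_add, Matrix.mulVec_smul]
    simp only [Pi.add_apply, Pi.smul_apply, smul_eq_mul]
    by_cases hij : classOf A i = classOf A j
    · rw [mulVec_apply_eq_zero (x := w) hA fun k hk => hw0 k fun h =>
          ((hmem k).1 h).2 ((classOf_eq_iff.2 ⟨((hmem k).1 h).1,
            (classOf_eq_iff.1 hij).2.trans (Relation.ReflTransGen.single hk)⟩)),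
        hw0 i fun h => ((hmem i).1 h).2 hij, hu.eigen i hij, mul_zero, zero_add, zero_add]
    · by_cases hacc : VertexAccess A i j
      · have := hK i ((hmem i).2 ⟨hacc, hij⟩)
        rw [hu.eq_zero hij]
        linarith
      · have hno : ∀ k, 0 < A i k → ¬ VertexAccess A k j := fun k hk h =>
          hacc (Relation.ReflTransGen.head hk h)
        rw [mulVec_apply_eq_zero (x := w) hA fun k hk => hw0 k fun h =>
            hno k hk ((hmem k).1 h).1,
          mulVec_apply_eq_zero (x := u) hA fun k hk => hu.eq_zero fun h =>
            hno k hk (classOf_eq_iff.1 h).1,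
          hw0 i fun h => hacc ((hmem i).1 h).1, hu.eq_zero hij]
        simp
  have hpow : ∀ m : ℕ, (A ^ m) *ᵥ u ≤ r ^ m • (K • w + u) := by
    intro m
    induction m with
    | zero =>
      simp only [pow_zero, Matrix.one_mulVec, one_smul]
      exact le_add_of_nonneg_left (smul_nonneg hKpos.le hw)
    | succ m ih =>
      rw [← Matrix.pow_mulVec_succ]
      refine (Matrix.mulVec_mono_of_nonneg hA ih).trans ?_
      rw [Matrix.mulVec_smul, pow_succ, mul_smul]
      exact smul_le_smul_of_nonneg_left hsuper (pow_nonneg hr.le m)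
  refine ⟨K • w + u, fun m => ?_⟩
  have := smul_le_smul_of_nonneg_left (hpow m) (inv_nonneg.2 (pow_pos hr m).le)
  rwa [smul_smul, inv_mul_cancel₀ (pow_pos hr m).ne', one_smul] at this

/-- A path from $\beta$ to $\alpha$ leaves $\beta$ by an arrow into the support of $x$. So on
$\beta$ the block alone falls strictly short of the eigenvalue equation at some coordinate, and
`classRadius_lt` applies. -/
theorem IsDistinguishedEigenvector.isDistinguished (hA : ∀ i j, 0 ≤ A i j)
    (hprim : HasPrimitiveBlocks A) {α : ComClass A} {x : Fin N → ℝ}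
    (hx : IsDistinguishedEigenvector A α x) : IsDistinguished A α := by
  intro β hβα hacc
  obtain ⟨j, rfl⟩ := classOf_surjective α
  obtain ⟨i, rfl⟩ := classOf_surjective β
  obtain ⟨hxe, hx0, hpos⟩ := hx
  simp only [exists_member_access_iff] at hpos
  have hij := classAccess_classOf.1 hacc
  obtain ⟨a, b, ha, hb, hab, hbj⟩ := exists_edge_leaving_class hij hβα
  exact classRadius_lt hA hprim hx0
    (fun k hk => (hpos k).2 ((classOf_eq_iff.1 hk).1.trans hij))
    (fun k _ => (congrFun hxe k).le) ha hb hab ((hpos b).2 hbj)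

/-- Take an arrow into the class. If it starts inside, the block is nonzero; if it starts outside,
the radius strictly exceeds a non-negative one. -/
theorem IsDistinguished.classRadius_pos (hA : ∀ i j, 0 ≤ A i j) (hprim : HasPrimitiveBlocks A)
    (hcol : ∀ j, ∃ i, 0 < A i j) {α : ComClass A} (hα : IsDistinguished A α) :
    0 < classRadius A α := by
  obtain ⟨j, rfl⟩ := classOf_surjective α
  obtain ⟨i, hij⟩ := hcol j
  by_cases h : classOf A i = classOf A j
  · exact _root_.classRadius_pos hA hprim h hij
  · exact (classRadius_nonneg _).trans_lt
      (hα _ h (classAccess_classOf.2 (Relation.ReflTransGen.single hij)))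

/-- The core is generated by one distinguished eigenvector for each distinguished class. -/
theorem exists_matrixCore_generators (hA : ∀ i j, 0 ≤ A i j) (hprim : HasPrimitiveBlocks A)
    (hcol : ∀ j, ∃ i, 0 < A i j) :
    ∃ X : ComClass A → Fin N → ℝ,
      (∀ α, IsDistinguished A α → IsDistinguishedEigenvector A α (X α)) ∧
      ∀ x ∈ matrixCore A, ∃ c : ComClass A → ℝ, (∀ α, 0 ≤ c α) ∧
        (∀ α, c α ≠ 0 → IsDistinguished A α) ∧ x = ∑ α, c α • X α := by
  classical
  choose U hU horbit using exists_isClassVector hA hprim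
  have hex : ∀ α, ∃ x, IsDistinguished A α → (IsDistinguishedEigenvector A α x ∧ U α ≤ x ∧
      ∀ z', (∀ m : ℕ, (classRadius A α ^ m)⁻¹ • ((A ^ m) *ᵥ U α) ≤ z') → x ≤ z') := by
    intro α
    by_cases hα : IsDistinguished A α
    · have hr := hα.classRadius_pos hA hprim hcol
      obtain ⟨z, hz⟩ := hα.exists_bound hA hprim hr (hU α)
      obtain ⟨x, hx⟩ := exists_distinguishedEigenvector_of_bounded hA hr (hU α) hz
      exact ⟨x, fun _ => hx⟩
    · exact ⟨0, fun h => absurd h hα⟩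
  choose X hX using hex
  refine ⟨X, fun α hα => (hX α hα).1, ?_⟩
  -- The induction runs over the support of a whole backward orbit: a subtraction stays in the core
  -- only if it is legitimate at every level.
  suffices H : ∀ T : Finset (Fin N), (∀ i j, j ∈ T → 0 < A i j → i ∈ T) →
      ∀ y, IsBackwardOrbit A y → (∀ k i, i ∉ T → y k i = 0) →
      ∃ c : ComClass A → ℝ, (∀ α, 0 ≤ c α) ∧
        (∀ α, c α ≠ 0 → IsDistinguished A α) ∧ y 0 = ∑ α, c α • X α by
    intro x hx
    obtain ⟨y, hy, rfl⟩ := exists_backwardOrbit hA hx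
    exact H Finset.univ (fun i _ _ _ => Finset.mem_univ i) y hy
      (fun k i hi => absurd (Finset.mem_univ i) hi)
  intro T
  induction T using Finset.strongInduction with
  | H T ih =>
    intro hup y hy hsupp
    rcases T.eq_empty_or_nonempty with rfl | hne
    · refine ⟨0, fun _ => le_rfl, fun _ h => absurd rfl h, ?_⟩
      ext i
      simp [hsupp 0 i]
    obtain ⟨j, hj, hfinal⟩ := exists_final_class (A := A) hne
    set α := classOf A j
    set r := classRadius A α
    -- The final class receives nothing from the rest of the support, so the orbit restricts to a
    -- backward orbit of its block.
    obtain ⟨c₀, hc₀, hcr, hcy⟩ := horbit α y hy fun k i l hi hl => by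
      by_cases hlT : l ∈ T
      · have : A i l = 0 := le_antisymm (not_lt.1 fun h => hl (hfinal i l hi hlT h)) (hA i l)
        rw [this, zero_mul]
      · rw [hsupp _ l hlT, mul_zero]
    set T' := T.filter fun i => classOf A i ≠ α with hT'
    have hmem : ∀ i, i ∈ T' ↔ i ∈ T ∧ classOf A i ≠ α := fun i => Finset.mem_filter
    have hssub : T' ⊂ T := ⟨Finset.filter_subset _ _, fun h => ((hmem j).1 (h hj)).2 rfl⟩
    have hup' : ∀ i k, k ∈ T' → 0 < A i k → i ∈ T' := fun i k hk hik =>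
      (hmem i).2 ⟨hup i k ((hmem k).1 hk).1 hik, fun h =>
        ((hmem k).1 hk).2 (hfinal i k h ((hmem k).1 hk).1 hik)⟩
    rcases hc₀.eq_or_lt with hc | hc
    · refine ih T' hssub hup' y hy fun k i hi => ?_
      by_cases hiT : i ∈ T
      · have hiα : classOf A i = α := by
          by_contra h
          exact hi ((hmem i).2 ⟨hiT, h⟩)
        rw [hcy k i hiα, ← hc, zero_mul, zero_mul]
      · exact hsupp k i hiT
    · have hr : 0 < r := lt_of_le_of_ne (classRadius_nonneg α) fun h => hc.ne' (hcr h.symm)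
      have hle : ∀ l, (c₀ * (r ^ l)⁻¹) • U α ≤ y l := by
        intro l i
        by_cases hi : classOf A i = α
        · exact (hcy l i hi).ge
        · simp only [Pi.smul_apply, (hU α).eq_zero hi, smul_zero]
          exact hy.1 l i
      -- From $y_l=A^my_{l+m}\ge c_0r^{-(l+m)}A^mu$.
      have hbound : ∀ l m : ℕ, (r ^ m)⁻¹ • ((A ^ m) *ᵥ U α) ≤ (c₀ * (r ^ l)⁻¹)⁻¹ • y l := by
        intro l m
        have h1 := Matrix.mulVec_mono_of_nonneg (Matrix.pow_nonneg_entries hA m) (hle (l + m))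
        rw [Matrix.pow_mulVec_backward hy.2, Matrix.mulVec_smul] at h1
        have hpos : 0 < c₀ * (r ^ l)⁻¹ := by positivity
        have h2 := smul_le_smul_of_nonneg_left h1 (inv_nonneg.2 hpos.le)
        rw [pow_add, mul_inv (r ^ l), ← mul_assoc, smul_smul, ← mul_assoc,
          inv_mul_cancel₀ hpos.ne', one_mul] at h2
        exact h2
      have hdist : IsDistinguished A α := by
        obtain ⟨x, hx, -⟩ := exists_distinguishedEigenvector_of_bounded hA hr (hU α) (hbound 0)
        exact hx.isDistinguished hA hprim
      obtain ⟨hXe, hUX, hXmin⟩ := hX α hdist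
      -- Leastness of $X_\alpha$ among the bounds, applied at each level $l$, is what keeps the
      -- difference of orbits non-negative.
      have hXle : ∀ l, (c₀ * (r ^ l)⁻¹) • X α ≤ y l := by
        intro l
        have hpos : 0 < c₀ * (r ^ l)⁻¹ := by positivity
        have := smul_le_smul_of_nonneg_left (hXmin _ (hbound l)) hpos.le
        rwa [smul_smul, mul_inv_cancel₀ hpos.ne', one_smul] at this
      have hXorb := IsBackwardOrbit.of_eigenvector hXe.2.1 hr hXe.1
      have hy' : IsBackwardOrbit A fun k => y k - (c₀ * (r ^ k)⁻¹) • X α := by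
        refine ⟨fun k => sub_nonneg.2 (hXle k), fun k => ?_⟩
        have h1 := hXorb.2 k
        simp only at h1 ⊢
        rw [Matrix.mulVec_sub, hy.2, mul_smul, mul_smul, Matrix.mulVec_smul, h1]
      -- On $\alpha$ the orbit equals $c_0r^{-k}u\le c_0r^{-k}X_\alpha$, while the difference is
      -- non-negative; so it vanishes there and the support shrinks.
      obtain ⟨c, hc0, hcd, hsum⟩ := ih T' hssub hup' _ hy' fun k i hi => by
        have h0 := hy'.1 k i
        have hXi := hXle k i
        simp only [Pi.sub_apply, Pi.smul_apply, smul_eq_mul, Pi.zero_apply] at h0 hXi ⊢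
        have hpos : 0 < c₀ * (r ^ k)⁻¹ := by positivity
        by_cases hiT : i ∈ T
        · have hiα : classOf A i = α := by
            by_contra h
            exact hi ((hmem i).2 ⟨hiT, h⟩)
          rw [hcy k i hiα] at h0 hXi ⊢
          have := mul_le_mul_of_nonneg_left (hUX i) hpos.le
          linarith
        · rw [hsupp k i hiT] at h0 hXi ⊢
          have := mul_nonneg hpos.le (hXe.2.1 i)
          linarith
      refine ⟨fun β => c β + if β = α then c₀ else 0, fun β => ?_, fun β hβ => ?_, ?_⟩
      · have := hc0 β
        simp only
        split_ifs <;> linarith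
      · by_cases h : β = α
        · exact h ▸ hdist
        · refine hcd β ?_
          simpa [h] using hβ
      · simp only [add_smul, Finset.sum_add_distrib, ite_smul, zero_smul, Finset.sum_ite_eq',
          Finset.mem_univ, if_true]
        simp only [pow_zero, inv_one, mul_one] at hsum
        rw [← hsum, sub_add_cancel]

end Distinguished

/-! ### Extreme vectors of the core -/

section Extreme

variable {N : ℕ} {A : Matrix (Fin N) (Fin N) ℝ}

theorem IsDistinguishedEigenvector.mem_matrixCore {α : ComClass A} {x : Fin N → ℝ}
    (hx : IsDistinguishedEigenvector A α x) (hr : 0 < classRadius A α) : x ∈ matrixCore A := by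
  simpa using (IsBackwardOrbit.of_eigenvector hx.2.1 hr hx.1).mem_core 0

theorem IsDistinguishedEigenvector.ne_zero {α : ComClass A} {x : Fin N → ℝ}
    (hx : IsDistinguishedEigenvector A α x) : x ≠ 0 := by
  obtain ⟨j, rfl⟩ := classOf_surjective α
  exact fun h => ((hx.2.2 j).2 ⟨⟨j, rfl⟩, Relation.ReflTransGen.refl⟩).ne' (congrFun h j)

theorem IsDistinguishedEigenvector.smul {α : ComClass A} {x : Fin N → ℝ}
    (hx : IsDistinguishedEigenvector A α x) {c : ℝ} (hc : 0 < c) :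
    IsDistinguishedEigenvector A α (c • x) := by
  refine ⟨by rw [Matrix.mulVec_smul, hx.1, smul_comm], smul_nonneg hc.le hx.2.1, fun i => ?_⟩
  rw [← hx.2.2 i]
  exact ⟨fun h => pos_of_mul_pos_right h hc.le, fun h => mul_pos hc h⟩

/-- A distinguished eigenvector determines its class. -/
theorem IsDistinguishedEigenvector.class_unique {α β : ComClass A} {x : Fin N → ℝ}
    (hα : IsDistinguishedEigenvector A α x) (hβ : IsDistinguishedEigenvector A β x) : α = β := by
  obtain ⟨i, rfl⟩ := classOf_surjective α
  obtain ⟨j, rfl⟩ := classOf_surjective β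
  have h1 := hα.2.2
  have h2 := hβ.2.2
  simp only [exists_member_access_iff] at h1 h2
  exact classOf_eq_iff.2 ⟨(h2 i).1 ((h1 i).2 Relation.ReflTransGen.refl),
    (h1 j).1 ((h2 j).2 Relation.ReflTransGen.refl)⟩

/-- If `x - w` lies in the core for distinguished eigenvectors `x` and `w`, then these belong to the
same class. -/
theorem IsDistinguishedEigenvector.eq_of_sub_mem (hA : ∀ i j, 0 ≤ A i j) {α β : ComClass A}
    (hα : IsDistinguished A α) (hrα : 0 < classRadius A α) (hrβ : 0 < classRadius A β)
    {x w : Fin N → ℝ} (hx : IsDistinguishedEigenvector A α x)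
    (hw : IsDistinguishedEigenvector A β w) (hxw : x - w ∈ matrixCore A) : β = α := by
  by_contra hne
  obtain ⟨j, rfl⟩ := classOf_surjective α
  obtain ⟨i, rfl⟩ := classOf_surjective β
  have hxorb := IsBackwardOrbit.of_eigenvector hx.2.1 hrα hx.1
  have hworb := IsBackwardOrbit.of_eigenvector hw.2.1 hrβ hw.1
  obtain ⟨z, hz, hz0⟩ := exists_backwardOrbit hA hxw
  have hsum := hz.linear_comb hworb zero_le_one zero_le_one
  -- By uniqueness the orbits of $x-w$ and $w$ add up to that of $x$, so
  -- $\rho_\beta^{-k}w\le\rho_\alpha^{-k}x$ for every $k$. At $k=0$ this gives access of $\beta$ to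
  -- $\alpha$, hence $\rho_\beta<\rho_\alpha$, and large $k$ contradicts it.
  have hle : ∀ k : ℕ, (classRadius A (classOf A i) ^ k)⁻¹ * w i ≤
      (classRadius A (classOf A j) ^ k)⁻¹ * x i := by
    intro k
    have h1 := congrFun (hsum.unique hxorb (by simp [hz0]) k) i
    have h2 := hz.1 k i
    simp only [one_smul, Pi.add_apply, Pi.smul_apply, smul_eq_mul, Pi.zero_apply] at h1 h2
    linarith
  have hwi : 0 < w i := (hw.2.2 i).2 ⟨⟨i, rfl⟩, Relation.ReflTransGen.refl⟩
  have hxi : 0 < x i := by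
    have := hle 0
    simp only [pow_zero, inv_one, one_mul] at this
    linarith
  have hacc : VertexAccess A i j := exists_member_access_iff.1 ((hx.2.2 i).1 hxi)
  have hlt := hα _ hne (classAccess_classOf.2 hacc)
  obtain ⟨k, hk⟩ := pow_unbounded_of_one_lt (x i / w i) ((one_lt_div hrβ).2 hlt)
  have := hle k
  rw [div_pow, div_lt_div_iff₀ hwi (pow_pos hrβ k)] at hk
  rw [inv_mul_eq_div, inv_mul_eq_div, div_le_div_iff₀ (pow_pos hrβ k) (pow_pos hrα k)] at this
  linarith

theorem isConvexCone_smul_mem {C : Set (Fin N → ℝ)} (hC : IsConvexCone C) {x : Fin N → ℝ}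
    (hx : x ∈ C) {a : ℝ} (ha : 0 ≤ a) : a • x ∈ C := by
  simpa using hC x hx x hx a 0 ha le_rfl

/-- The extreme vectors of the core are the distinguished eigenvectors, and these are unique up to
scaling. -/
theorem extreme_matrixCore (hA : ∀ i j, 0 ≤ A i j) (hprim : HasPrimitiveBlocks A)
    (hcol : ∀ j, ∃ i, 0 < A i j) :
    (∀ x, IsExtremeVector (matrixCore A) x ↔
      ∃ α, IsDistinguished A α ∧ IsDistinguishedEigenvector A α x) ∧
    (∀ α, IsDistinguished A α → ∃ x, IsDistinguishedEigenvector A α x) ∧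
    ∀ α x y, IsDistinguished A α → IsDistinguishedEigenvector A α x →
      IsDistinguishedEigenvector A α y → ∃ c : ℝ, 0 < c ∧ y = c • x := by
  classical
  obtain ⟨X, hX, hgen⟩ := exists_matrixCore_generators hA hprim hcol
  have hcone := matrixCore_isConvexCone hA
  have hpos : ∀ α, IsDistinguished A α → 0 < classRadius A α := fun α hα =>
    hα.classRadius_pos hA hprim hcol
  have hterm : ∀ (c : ComClass A → ℝ), (∀ α, 0 ≤ c α) → (∀ α, c α ≠ 0 → IsDistinguished A α) →
      ∀ α, c α • X α ∈ matrixCore A := by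
    intro c hc hcd α
    by_cases h : c α = 0
    · rw [h, zero_smul]
      exact zero_mem_matrixCore
    · exact isConvexCone_smul_mem hcone ((hX α (hcd α h)).mem_matrixCore (hpos α (hcd α h))) (hc α)
  have hrest : ∀ (c : ComClass A → ℝ), (∀ α, 0 ≤ c α) → (∀ α, c α ≠ 0 → IsDistinguished A α) →
      ∀ α, (∑ β, c β • X β) - c α • X α ∈ matrixCore A := by
    intro c hc hcd α
    rw [← Finset.add_sum_erase Finset.univ (fun β => c β • X β) (Finset.mem_univ α),
      add_sub_cancel_left]
    exact sum_mem_matrixCore hA _ fun β _ => hterm c hc hcd β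
  -- Expand the summand $y$ in the generators. A term of another class would be a distinguished
  -- eigenvector whose difference from $x$ lies in the core, which `eq_of_sub_mem` excludes.
  have hface : ∀ α x, IsDistinguished A α → IsDistinguishedEigenvector A α x →
      ∀ y ∈ matrixCore A, x - y ∈ matrixCore A → ∃ c : ℝ, 0 ≤ c ∧ y = c • X α := by
    intro α x hα hx y hy hxy
    obtain ⟨c, hc, hcd, rfl⟩ := hgen y hy
    refine ⟨c α, hc α, Finset.sum_eq_single_of_mem α (Finset.mem_univ α) fun β _ hβ => ?_⟩
    by_contra hne
    have hcβ : c β ≠ 0 := fun h => hne (by rw [h, zero_smul])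
    have hβd := hcd β hcβ
    refine hβ (hx.eq_of_sub_mem hA hα (hpos α hα) (hpos β hβd)
      ((hX β hβd).smul (lt_of_le_of_ne (hc β) hcβ.symm)) ?_)
    have := hcone _ hxy _ (hrest c hc hcd β) 1 1 zero_le_one zero_le_one
    rwa [one_smul, one_smul, sub_add_sub_cancel] at this
  have hscale : ∀ α x, IsDistinguished A α → IsDistinguishedEigenvector A α x →
      ∃ c : ℝ, 0 < c ∧ x = c • X α := by
    intro α x hα hx
    obtain ⟨c, hc, hcx⟩ := hface α x hα hx x (hx.mem_matrixCore (hpos α hα))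
      (by rw [sub_self]; exact zero_mem_matrixCore)
    refine ⟨c, lt_of_le_of_ne hc fun h => hx.ne_zero ?_, hcx⟩
    rw [hcx, ← h, zero_smul]
  refine ⟨fun x => ?_, fun α hα => ⟨X α, hX α hα⟩, fun α x y hα hx hy => ?_⟩
  · rw [isExtremeVector_iff hcone fun x hx => matrixCore_nonneg hA hx]
    constructor
    -- Some generator term of $x$ is nonzero; by extremality it is a multiple of $x$.
    · rintro ⟨hx, hx0, hext⟩
      obtain ⟨c, hc, hcd, rfl⟩ := hgen x hx
      obtain ⟨α, -, hα⟩ := Finset.exists_ne_zero_of_sum_ne_zero hx0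
      have hcα : c α ≠ 0 := fun h => hα (by rw [h, zero_smul])
      obtain ⟨t, ht, htx⟩ := hext _ (hterm c hc hcd α) (hrest c hc hcd α)
      have ht0 : t ≠ 0 := fun h => hα (by rw [htx, h, zero_smul])
      refine ⟨α, hcd α hcα, ?_⟩
      have h1 := (hX α (hcd α hcα)).smul (lt_of_le_of_ne (hc α) hcα.symm)
      have h2 := h1.smul (inv_pos.2 (lt_of_le_of_ne ht ht0.symm))
      rwa [htx, smul_smul, inv_mul_cancel₀ ht0, one_smul] at h2
    · rintro ⟨α, hα, hx⟩
      refine ⟨hx.mem_matrixCore (hpos α hα), hx.ne_zero, fun y hy hxy => ?_⟩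
      obtain ⟨c, hc, rfl⟩ := hface α x hα hx y hy hxy
      obtain ⟨d, hd, hdx⟩ := hscale α x hα hx
      exact ⟨c / d, by positivity, by rw [hdx, smul_smul, div_mul_cancel₀ _ hd.ne']⟩
  · obtain ⟨c, hc, rfl⟩ := hscale α x hα hx
    obtain ⟨d, hd, rfl⟩ := hscale α y hα hy
    exact ⟨d / c, by positivity, by rw [smul_smul, div_mul_cancel₀ _ hc.ne']⟩

/-- Transposition preserves primitivity of the blocks. -/
theorem HasPrimitiveBlocks.transpose (h : HasPrimitiveBlocks A) : HasPrimitiveBlocks Aᵀ := by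
  intro α hα
  have hacc : ∀ {i j}, VertexAccess Aᵀ i j ↔ VertexAccess A j i := by
    intro i j
    rw [VertexAccess, VertexAccess, ← Relation.reflTransGen_swap]
    rfl
  have hcls : ∀ {i j}, classOf Aᵀ i = classOf Aᵀ j ↔ classOf A i = classOf A j := by
    intro i j
    rw [classOf_eq_iff, classOf_eq_iff, hacc, hacc, and_comm]
  obtain ⟨a, rfl⟩ := classOf_surjective α
  let e : (classOf Aᵀ a).Members ≃ (classOf A a).Members :=
    Equiv.subtypeEquivRight fun i => hcls (i := i) (j := a)
  have hblock : diagBlock Aᵀ (classOf Aᵀ a) = (diagBlock A (classOf A a))ᵀ.submatrix e e := rfl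
  have hne : diagBlock A (classOf A a) ≠ 0 := fun h0 => hα (by rw [hblock, h0]; rfl)
  obtain ⟨h0, k, hk, hpos⟩ := h _ hne
  refine ⟨fun i j => h0 (e j) (e i), k, hk, fun i j => ?_⟩
  have hpow : ∀ m : ℕ, ((diagBlock A (classOf A a))ᵀ.submatrix e e) ^ m =
      ((diagBlock A (classOf A a))ᵀ ^ m).submatrix e e := by
    intro m
    induction m with
    | zero => rw [pow_zero, pow_zero, Matrix.submatrix_one_equiv]
    | succ m ih => rw [pow_succ, ih, pow_succ, Matrix.submatrix_mul_equiv]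
  rw [hblock, hpow, ← Matrix.transpose_pow]
  exact hpos (e j) (e i)

end Extreme

/-! ### The path space -/

namespace BratteliDiagram

variable {B : BratteliDiagram.{u, v}}

instance (n : ℕ) : Finite (B.E n) := B.finite_E n

instance (n : ℕ) : MeasurableSpace (B.E n) := ⊤

instance (n : ℕ) : DiscreteMeasurableSpace (B.E n) := ⟨fun _ => trivial⟩

theorem exists_path_extending (p : ∀ i, B.E i) (n : ℕ) (hp : ∀ i < n, B.r (p i) = B.s (p (i + 1))) :
    ∃ x : B.PathSpace, ∀ i ≤ n, x.edge i = p i := by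
  let f : ∀ i, B.E i := fun i => Nat.rec (motive := B.E) (p 0)
    (fun i e => if i + 1 ≤ n then p (i + 1) else (B.s_surjective (i + 1) (B.r e)).choose) i
  have hsucc : ∀ i, f (i + 1) =
      if i + 1 ≤ n then p (i + 1) else (B.s_surjective (i + 1) (B.r (f i))).choose := fun i => rfl
  have hf : ∀ i ≤ n, f i = p i := by
    intro i hi
    cases i with
    | zero => rfl
    | succ i => rw [hsucc, if_pos hi]
  refine ⟨⟨f, fun i => ?_⟩, hf⟩
  rw [hsucc]
  split_ifs with h
  · rw [hf i (by omega), hp i (by omega)]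
  · exact (B.s_surjective (i + 1) (B.r (f i))).choose_spec.symm

theorem exists_path_append (x : B.PathSpace) (n : ℕ) (e : B.E (n + 1))
    (h : B.r (x.edge n) = B.s e) : ∃ y ∈ cylinder x (n + 1), y.edge (n + 1) = e := by
  obtain ⟨y, hy⟩ := exists_path_extending (Function.update x.edge (n + 1) e) (n + 1) (by
    intro i hi
    rw [Function.update_of_ne (by omega)]
    rcases Nat.lt_succ_iff_lt_or_eq.1 hi with hlt | rfl
    · rw [Function.update_of_ne (by omega)]
      exact x.compat i
    · rw [Function.update_self]
      exact h)
  exact ⟨y, fun i hi => (hy i hi.le).trans (Function.update_of_ne (by omega) _ _),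
    (hy _ le_rfl).trans (Function.update_self _ _ _)⟩

/-- Receiving edges allow a continuation back to the root, emitted edges a continuation to infinity;
hence cylinders around infinite paths account for all finite paths. -/
theorem exists_path_edge (n : ℕ) (e : B.E n) : ∃ x : B.PathSpace, x.edge n = e := by
  have : ∀ i, Nonempty (B.E i) := by
    intro i
    induction i with
    | zero =>
      obtain ⟨v, -⟩ := B.root_unique
      exact ⟨(B.s_surjective 0 v).choose⟩
    | succ i ih => exact ⟨(B.s_surjective (i + 1) (B.r ih.some)).choose⟩
  induction n with
  | zero =>
    obtain ⟨x, hx⟩ := exists_path_extending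
      (Function.update (fun i => (this i).some) 0 e) 0 (fun i hi => absurd hi (by omega))
    exact ⟨x, (hx 0 le_rfl).trans (Function.update_self _ _ _)⟩
  | succ n ih =>
    obtain ⟨e', he'⟩ := B.r_surjective n (B.s e)
    obtain ⟨x, rfl⟩ := ih e'
    obtain ⟨y, -, hy⟩ := exists_path_append x n e he'
    exact ⟨y, hy⟩

instance : Nonempty B.PathSpace := by
  obtain ⟨v, -⟩ := B.root_unique
  obtain ⟨x, -⟩ := exists_path_edge 0 (B.s_surjective 0 v).choose
  exact ⟨x⟩

theorem exists_path_vertex (n : ℕ) (w : B.V (n + 1)) : ∃ x : B.PathSpace, B.r (x.edge n) = w := by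
  obtain ⟨e, rfl⟩ := B.r_surjective n w
  obtain ⟨x, rfl⟩ := exists_path_edge n e
  exact ⟨x, rfl⟩

/-! ### Cylinder sets and the Borel structure -/

theorem mem_cylinder_iff {x y : B.PathSpace} {n : ℕ} :
    y ∈ cylinder x n ↔ ∀ i < n, y.edge i = x.edge i := Iff.rfl

theorem mem_cylinder_self (x : B.PathSpace) (n : ℕ) : x ∈ cylinder x n := fun _ _ => rfl

theorem cylinder_eq_of_mem {x y : B.PathSpace} {n : ℕ} (h : y ∈ cylinder x n) :
    cylinder y n = cylinder x n := by
  ext z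
  exact ⟨fun hz i hi => (hz i hi).trans (h i hi), fun hz i hi => (hz i hi).trans (h i hi).symm⟩

theorem cylinder_anti (x : B.PathSpace) {m n : ℕ} (h : m ≤ n) : cylinder x n ⊆ cylinder x m :=
  fun _ hy i hi => hy i (hi.trans_le h)

/-- A countable set of paths realizes all finite paths. -/
theorem exists_countable_dense : ∃ Q : Set B.PathSpace, Q.Countable ∧
    ∀ (x : B.PathSpace) (n : ℕ), ∃ q ∈ Q, q ∈ cylinder x n := by
  let f : ∀ n, B.PathSpace → (∀ i : Fin n, B.E i) := fun n x i => x.edge i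
  refine ⟨⋃ n, Set.range (Set.rangeSplitting (f n)), ?_, fun x n => ?_⟩
  · exact Set.countable_iUnion fun n => Set.countable_range _
  · refine ⟨_, Set.mem_iUnion.2 ⟨n, ⟨⟨f n x, x, rfl⟩, rfl⟩⟩, fun i hi => ?_⟩
    exact congrFun (Set.apply_rangeSplitting (f n) ⟨f n x, x, rfl⟩) ⟨i, hi⟩

variable (B) in
/-- The cylinder sets of length at least `k`. -/
def cylindersFrom (k : ℕ) : Set (Set B.PathSpace) := {U | ∃ x, ∃ m ≥ k, U = cylinder x m}

theorem cylindersFrom_countable (k : ℕ) : (cylindersFrom B k).Countable := by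
  obtain ⟨Q, hQ, hdense⟩ := exists_countable_dense (B := B)
  refine ((hQ.prod (Set.countable_univ (α := ℕ))).image fun p => cylinder p.1 p.2).mono ?_
  rintro _ ⟨x, m, -, rfl⟩
  obtain ⟨q, hq, hqx⟩ := hdense x m
  exact ⟨(q, m), ⟨hq, trivial⟩, cylinder_eq_of_mem hqx⟩

theorem cylindersFrom_isPiSystem (k : ℕ) : IsPiSystem (cylindersFrom B k) := by
  rintro _ ⟨x, m, hm, rfl⟩ _ ⟨y, l, -, rfl⟩ ⟨z, hzx, hzy⟩
  refine ⟨z, max m l, hm.trans (le_max_left _ _), ?_⟩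
  rw [← cylinder_eq_of_mem hzx, ← cylinder_eq_of_mem hzy]
  ext w
  constructor
  · exact fun hw i hi => (lt_max_iff.1 hi).elim (hw.1 i) (hw.2 i)
  · exact fun hw =>
      ⟨cylinder_anti z (le_max_left _ _) hw, cylinder_anti z (le_max_right _ _) hw⟩

instance : SecondCountableTopology B.PathSpace where
  is_open_generated_countable := by
    refine ⟨cylindersFrom B 0, cylindersFrom_countable 0, ?_⟩
    change TopologicalSpace.generateFrom _ = _
    congr 1
    ext U
    simp [cylindersFrom]

theorem measurableSet_cylinder (x : B.PathSpace) (n : ℕ) : MeasurableSet (cylinder x n) :=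
  IsOpen.measurableSet (TopologicalSpace.isOpen_generateFrom_of_mem
    (show cylinder x n ∈ {U | ∃ x n, U = cylinder x n} from ⟨x, n, rfl⟩))

/-- A short cylinder is a countable union of long ones. The freedom in $k$ matters because an
exchange of segments of length $n+1$ maps cylinders to cylinders only from that length on. -/
theorem generateFrom_cylindersFrom (k : ℕ) :
    (inferInstance : MeasurableSpace B.PathSpace) =
      MeasurableSpace.generateFrom (cylindersFrom B k) := by
  refine le_antisymm ?_ (MeasurableSpace.generateFrom_le ?_)
  · change borel _ ≤ _
    rw [borel_eq_generateFrom_of_subbasis (s := {U | ∃ x n, U = cylinder x n}) rfl]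
    refine MeasurableSpace.generateFrom_le ?_
    rintro _ ⟨x, n, rfl⟩
    have : cylinder x n = ⋃₀ {U | U ∈ cylindersFrom B k ∧ U ⊆ cylinder x n} := by
      refine Set.Subset.antisymm (fun y hy => ?_) (Set.sUnion_subset fun U hU => hU.2)
      refine ⟨cylinder y (max n k), ⟨⟨y, _, le_max_right _ _, rfl⟩, ?_⟩, mem_cylinder_self _ _⟩
      rw [← cylinder_eq_of_mem hy]
      exact cylinder_anti y (le_max_left _ _)
    rw [this]
    exact MeasurableSet.sUnion ((cylindersFrom_countable k).mono fun U hU => hU.1)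
      fun U hU => MeasurableSpace.measurableSet_generateFrom hU.1
  · rintro _ ⟨x, m, -, rfl⟩
    exact measurableSet_cylinder x m

theorem measurable_edge (n : ℕ) : Measurable fun x : B.PathSpace => x.edge n := by
  refine measurable_to_countable' fun e => ?_
  have : (fun x : B.PathSpace => x.edge n) ⁻¹' {e} =
      ⋃₀ {U | U ∈ cylindersFrom B (n + 1) ∧ U ⊆ (fun x : B.PathSpace => x.edge n) ⁻¹' {e}} := by
    refine Set.Subset.antisymm (fun y hy => ?_) (Set.sUnion_subset fun U hU => hU.2)
    refine ⟨cylinder y (n + 1), ⟨⟨y, _, le_rfl, rfl⟩, fun z hz => ?_⟩, mem_cylinder_self _ _⟩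
    exact (hz n (Nat.lt_succ_self n)).trans hy
  rw [this]
  refine MeasurableSet.sUnion ((cylindersFrom_countable (n + 1)).mono fun U hU => hU.1) ?_
  rintro _ ⟨⟨x, m, -, rfl⟩, -⟩
  exact measurableSet_cylinder x m

theorem measurable_of_edge {X : Type*} [MeasurableSpace X] {f : X → B.PathSpace}
    (hf : ∀ n, Measurable fun x => (f x).edge n) : Measurable f := by
  refine Measurable.mono (measurable_generateFrom (s := cylindersFrom B 0) ?_) le_rfl
    (generateFrom_cylindersFrom 0).le
  rintro _ ⟨x, m, -, rfl⟩
  have : f ⁻¹' cylinder x m = ⋂ i, ⋂ _ : i < m, (fun y => (f y).edge i) ⁻¹' {x.edge i} := by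
    ext y
    simp [mem_cylinder_iff]
  rw [this]
  exact MeasurableSet.iInter fun i => MeasurableSet.iInter fun _ => hf i (MeasurableSet.of_discrete)

theorem measurableSet_eq_paths {X : Type*} [MeasurableSpace X] {f g : X → B.PathSpace}
    (hf : Measurable f) (hg : Measurable g) : MeasurableSet {x | f x = g x} := by
  have : {x | f x = g x} = ⋂ n, {x | (f x).edge n = (g x).edge n} := by
    ext x
    simp [PathSpace.ext_iff, funext_iff]
  rw [this]
  exact MeasurableSet.iInter fun n =>
    measurableSet_eq_fun ((measurable_edge n).comp hf) ((measurable_edge n).comp hg)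

/-! ### Tail equivalence and exchanges of initial segments -/

theorem TailEquiv.refl (x : B.PathSpace) : TailEquiv x x := ⟨0, fun _ _ => rfl⟩

theorem TailEquiv.symm {x y : B.PathSpace} (h : TailEquiv x y) : TailEquiv y x :=
  let ⟨i, hi⟩ := h
  ⟨i, fun j hj => (hi j hj).symm⟩

theorem TailEquiv.trans {x y z : B.PathSpace} (h : TailEquiv x y) (h' : TailEquiv y z) :
    TailEquiv x z :=
  let ⟨i, hi⟩ := h
  let ⟨j, hj⟩ := h'
  ⟨max i j, fun k hk => (hi k (le_of_max_le_left hk)).trans (hj k (le_of_max_le_right hk))⟩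

open Classical in
/-- The map that exchanges the initial segments of length `n + 1` of `a` and `b`. -/
noncomputable def exchange (n : ℕ) (a b : B.PathSpace) (h : B.r (a.edge n) = B.r (b.edge n))
    (x : B.PathSpace) : B.PathSpace where
  edge i :=
    if i ≤ n ∧ x ∈ cylinder a (n + 1) then b.edge i
    else if i ≤ n ∧ x ∈ cylinder b (n + 1) then a.edge i
    else x.edge i
  compat i := by
    rcases lt_trichotomy i n with hi | rfl | hi
    · have h1 : i ≤ n := hi.le
      have h2 : i + 1 ≤ n := hi
      simp only [h1, h2, true_and]
      split_ifs
      · exact b.compat i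
      · exact a.compat i
      · exact x.compat i
    -- The junction: the new segment ends at the same vertex as the old one.
    · have h1 : ¬ i + 1 ≤ i := by omega
      simp only [h1, le_refl, true_and, false_and, if_false]
      split_ifs with ha hb
      · rw [← x.compat i, ha i (Nat.lt_succ_self i), h]
      · rw [← x.compat i, hb i (Nat.lt_succ_self i), h]
      · exact x.compat i
    · have h1 : ¬ i ≤ n := by omega
      have h2 : ¬ i + 1 ≤ n := by omega
      simp only [h1, h2, false_and, if_false]
      exact x.compat i

section Exchange

variable {n : ℕ} {a b : B.PathSpace} {h : B.r (a.edge n) = B.r (b.edge n)}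

theorem exchange_edge_of_gt (x : B.PathSpace) {i : ℕ} (hi : n < i) :
    (exchange n a b h x).edge i = x.edge i := by
  have h1 : ¬ i ≤ n := by omega
  simp [exchange, h1]

theorem exchange_edge_of_mem_left {x : B.PathSpace} (hx : x ∈ cylinder a (n + 1)) {i : ℕ}
    (hi : i ≤ n) : (exchange n a b h x).edge i = b.edge i := by
  simp [exchange, hx, hi]

theorem exchange_edge_of_mem_right {x : B.PathSpace} (hx : x ∈ cylinder b (n + 1)) {i : ℕ}
    (hi : i ≤ n) : (exchange n a b h x).edge i = a.edge i := by
  by_cases ha : x ∈ cylinder a (n + 1)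
  · rw [exchange_edge_of_mem_left ha hi, ← hx i (by omega), ha i (by omega)]
  · simp [exchange, hx, hi, ha]

theorem exchange_of_notMem {x : B.PathSpace} (ha : x ∉ cylinder a (n + 1))
    (hb : x ∉ cylinder b (n + 1)) : exchange n a b h x = x := by
  ext i
  simp [exchange, ha, hb]

theorem exchange_mem_right {x : B.PathSpace} (hx : x ∈ cylinder a (n + 1)) :
    exchange n a b h x ∈ cylinder b (n + 1) :=
  fun _ hi => exchange_edge_of_mem_left hx (Nat.lt_succ_iff.1 hi)

theorem exchange_mem_left {x : B.PathSpace} (hx : x ∈ cylinder b (n + 1)) :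
    exchange n a b h x ∈ cylinder a (n + 1) :=
  fun _ hi => exchange_edge_of_mem_right hx (Nat.lt_succ_iff.1 hi)

theorem exchange_involutive : Function.Involutive (exchange n a b h) := by
  intro x
  by_cases ha : x ∈ cylinder a (n + 1)
  · ext i
    by_cases hi : i ≤ n
    · rw [exchange_edge_of_mem_right (exchange_mem_right ha) hi, ha i (by omega)]
    · rw [exchange_edge_of_gt _ (by omega), exchange_edge_of_gt _ (by omega)]
  · by_cases hb : x ∈ cylinder b (n + 1)
    · ext i
      by_cases hi : i ≤ n
      · rw [exchange_edge_of_mem_left (exchange_mem_left hb) hi, hb i (by omega)]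
      · rw [exchange_edge_of_gt _ (by omega), exchange_edge_of_gt _ (by omega)]
    · rw [exchange_of_notMem ha hb, exchange_of_notMem ha hb]

theorem exchange_agree {x y : B.PathSpace} {m : ℕ} (hm : n + 1 ≤ m) (hxy : x ∈ cylinder y m) :
    exchange n a b h x ∈ cylinder (exchange n a b h y) m := by
  have hcyl := cylinder_eq_of_mem (cylinder_anti y hm hxy)
  have hmem : ∀ c : B.PathSpace, x ∈ cylinder c (n + 1) ↔ y ∈ cylinder c (n + 1) := fun c =>
    ⟨fun hx i hi => (hxy i (by omega)).symm.trans (hx i hi),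
      fun hy i hi => (hxy i (by omega)).trans (hy i hi)⟩
  intro i hi
  by_cases ha : y ∈ cylinder a (n + 1) <;> by_cases hb : y ∈ cylinder b (n + 1) <;>
    simp [exchange, ha, hb, (hmem a).2, (hmem b).2, mt (hmem a).1, mt (hmem b).1, hxy i hi]

theorem preimage_exchange_cylinder (y : B.PathSpace) {m : ℕ} (hm : n + 1 ≤ m) :
    exchange n a b h ⁻¹' cylinder y m = cylinder (exchange n a b h y) m := by
  ext x
  refine ⟨fun hx => ?_, fun hx => ?_⟩
  · have := exchange_agree (h := h) hm hx
    rwa [exchange_involutive x] at this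
  · have := exchange_agree (h := h) hm hx
    rwa [exchange_involutive y] at this

theorem measurable_exchange : Measurable (exchange n a b h) := by
  classical
  refine measurable_of_edge fun i => ?_
  by_cases hi : i ≤ n
  · simp only [exchange, hi, true_and]
    exact Measurable.ite (measurableSet_cylinder a _) measurable_const
      (Measurable.ite (measurableSet_cylinder b _) measurable_const (measurable_edge i))
  · simp only [exchange, hi, false_and, if_false]
    exact measurable_edge i

end Exchange

variable (B) in
/-- The set of all exchanges of initial segments. -/
def exchanges : Set (Equiv.Perm B.PathSpace) :=
  {σ | ∃ n a b h, σ = (exchange_involutive (n := n) (a := a) (b := b) (h := h)).toPerm}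

/-- An exchange depends only on the two finite segments, which can be represented by paths from a
countable set. -/
theorem exchanges_countable : (exchanges B).Countable := by
  classical
  obtain ⟨Q, hQ, hdense⟩ := exists_countable_dense (B := B)
  have := hQ.to_subtype
  refine (Set.countable_range fun p : ℕ × Q × Q =>
    if h : B.r (p.2.1.1.edge p.1) = B.r (p.2.2.1.edge p.1) then
      (exchange_involutive (n := p.1) (a := p.2.1.1) (b := p.2.2.1) (h := h)).toPerm
    else 1).mono ?_
  rintro _ ⟨n, a, b, h, rfl⟩
  obtain ⟨p, hp, hpa⟩ := hdense a (n + 1)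
  obtain ⟨q, hq, hqb⟩ := hdense b (n + 1)
  have hpq : B.r (p.edge n) = B.r (q.edge n) := by rw [hpa n (by omega), hqb n (by omega), h]
  refine ⟨(n, ⟨p, hp⟩, ⟨q, hq⟩), ?_⟩
  simp only [hpq, dif_pos]
  ext x i
  simp only [Function.Involutive.coe_toPerm, exchange, cylinder_eq_of_mem hpa,
    cylinder_eq_of_mem hqb]
  by_cases hi : i ≤ n
  · rw [hpa i (by omega), hqb i (by omega)]
  · simp [hi]

theorem exchanges_nonempty : (exchanges B).Nonempty :=
  ⟨_, 0, Classical.arbitrary _, Classical.arbitrary _, rfl, rfl⟩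

theorem measurable_of_mem_exchanges {σ : Equiv.Perm B.PathSpace} (hσ : σ ∈ exchanges B) :
    Measurable σ := by
  obtain ⟨n, a, b, h, rfl⟩ := hσ
  exact measurable_exchange (h := h)

theorem inv_of_mem_exchanges {σ : Equiv.Perm B.PathSpace} (hσ : σ ∈ exchanges B) : σ⁻¹ = σ := by
  obtain ⟨n, a, b, h, rfl⟩ := hσ
  rfl

theorem tailEquiv_of_mem_exchanges {σ : Equiv.Perm B.PathSpace} (hσ : σ ∈ exchanges B)
    (x : B.PathSpace) : TailEquiv x (σ x) := by
  obtain ⟨n, a, b, h, rfl⟩ := hσ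
  exact ⟨n + 1, fun i hi => (exchange_edge_of_gt (h := h) x hi).symm⟩

theorem TailEquiv.exists_exchange {x y : B.PathSpace} (hxy : TailEquiv x y) :
    ∃ σ ∈ exchanges B, σ x = y := by
  obtain ⟨n, hn⟩ := hxy
  have h := congrArg B.r (hn n le_rfl)
  refine ⟨_, ⟨n, x, y, h, rfl⟩, ?_⟩
  ext i
  by_cases hi : i ≤ n
  · exact exchange_edge_of_mem_left (h := h) (mem_cylinder_self x _) hi
  · exact (exchange_edge_of_gt (h := h) x (by omega)).trans (hn i (by omega))

/-! ### Invariant measures -/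

theorem _root_.Subgroup.countable_closure {G : Type*} [Group G] {s : Set G} (hs : s.Countable) :
    Countable (Subgroup.closure s) := by
  have := hs.to_subtype
  rw [FreeGroup.closure_eq_range]
  exact (MonoidHom.rangeRestrict_surjective _).countable

/-- A measurable permutation that agrees at every point with one of countably many measure
preserving permutations is measure preserving. -/
theorem _root_.MeasureTheory.Measure.map_eq_self_of_piecewise {X : Type*} [MeasurableSpace X]
    {μ : Measure X} {g : Equiv.Perm X} (hg : Measurable g) (hg' : Measurable g.symm)
    {s : ℕ → Equiv.Perm X} (hs : ∀ k, Measurable (s k)) (hμ : ∀ k, μ.map (s k) = μ)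
    (hmeas : ∀ k, MeasurableSet {x | g x = s k x}) (hcover : ∀ x, ∃ k, g x = s k x) :
    μ.map g = μ := by
  set D : ℕ → Set X := disjointed fun k => {x | g x = s k x} with hD
  have hDm : ∀ k, MeasurableSet (D k) := fun k => MeasurableSet.disjointed hmeas k
  have hDdisj : Pairwise (Function.onFun Disjoint D) := disjoint_disjointed _
  have hDU : ⋃ k, D k = Set.univ := by
    rw [hD, iUnion_disjointed]
    exact Set.eq_univ_of_forall fun x => Set.mem_iUnion.2 (hcover x)
  have hDs : ∀ k, ∀ x ∈ D k, g x = s k x := fun k x hx => disjointed_subset _ k hx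
  ext S hS
  rw [Measure.map_apply hg hS]
  have h1 : μ (g ⁻¹' S) = ∑' k, μ (g ⁻¹' S ∩ D k) := by
    rw [← measure_iUnion (fun i j hij => (hDdisj hij).mono Set.inter_subset_right
      Set.inter_subset_right) fun k => (hg hS).inter (hDm k), ← Set.inter_iUnion, hDU,
      Set.inter_univ]
  have h2 : μ S = ∑' k, μ (S ∩ g.symm ⁻¹' D k) := by
    rw [← measure_iUnion (fun i j hij => ((hDdisj hij).preimage g.symm).mono Set.inter_subset_right
      Set.inter_subset_right) fun k => hS.inter (hg' (hDm k)), ← Set.inter_iUnion,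
      ← Set.preimage_iUnion, hDU, Set.preimage_univ, Set.inter_univ]
  rw [h1, h2]
  refine tsum_congr fun k => ?_
  have h3 : g ⁻¹' S ∩ D k = s k ⁻¹' (S ∩ g.symm ⁻¹' D k) := by
    ext x
    simp only [Set.mem_inter_iff, Set.mem_preimage]
    constructor
    · rintro ⟨hx, hxD⟩
      rw [← hDs k x hxD]
      exact ⟨hx, by rwa [Equiv.symm_apply_apply]⟩
    · rintro ⟨hx, hxD⟩
      have h4 := hDs k _ hxD
      rw [Equiv.apply_symm_apply] at h4
      have h5 := (s k).injective h4
      rw [← h5] at hxD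
      exact ⟨by rwa [hDs k x hxD], hxD⟩
  rw [h3, ← Measure.map_apply (hs k) (hS.inter (hg' (hDm k))), hμ k]

/-- The exchanges generate a countable group whose orbits are the tail classes, which gives one
direction. Conversely, an element of any admissible group agrees at each point with one of the
countably many exchanges. -/
theorem isInvariant_iff_exchanges {μ : Measure B.PathSpace} :
    IsInvariant μ ↔ ∀ σ ∈ exchanges B, μ.map σ = μ := by
  constructor
  · intro hμ σ hσ
    have hmeas : ∀ g ∈ Subgroup.closure (exchanges B), Measurable g ∧ Measurable (g⁻¹ : Equiv.Perm _)
        ∧ ∀ x, TailEquiv x (g x) := by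
      intro g hg
      induction hg using Subgroup.closure_induction with
      | mem σ hσ =>
        rw [inv_of_mem_exchanges hσ]
        exact ⟨measurable_of_mem_exchanges hσ, measurable_of_mem_exchanges hσ,
          tailEquiv_of_mem_exchanges hσ⟩
      | one => exact ⟨measurable_id, measurable_id, TailEquiv.refl⟩
      | mul g g' _ _ hg hg' =>
        refine ⟨hg.1.comp hg'.1, ?_, fun x => (hg'.2.2 x).trans (hg.2.2 _)⟩
        rw [mul_inv_rev]
        exact hg'.2.1.comp hg.2.1
      | inv g _ hg =>
        refine ⟨hg.2.1, by rw [inv_inv]; exact hg.1, fun x => ?_⟩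
        have := (hg.2.2 (g⁻¹ x)).symm
        rwa [← Equiv.Perm.mul_apply, mul_inv_cancel, Equiv.Perm.one_apply] at this
    refine hμ (Subgroup.closure (exchanges B)) (Subgroup.countable_closure exchanges_countable)
      (fun g hg => (hmeas g hg).1) (fun x y => ⟨fun hxy => ?_, ?_⟩) σ (Subgroup.subset_closure hσ)
    · obtain ⟨τ, hτ, hxy⟩ := hxy.exists_exchange
      exact ⟨τ, Subgroup.subset_closure hτ, hxy⟩
    · rintro ⟨g, hg, rfl⟩
      exact (hmeas g hg).2.2 x
  · intro hμ G _ hG horb g hg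
    obtain ⟨e, he⟩ := (exchanges_countable (B := B)).exists_eq_range exchanges_nonempty
    have hmem : ∀ k, e k ∈ exchanges B := fun k => he ▸ ⟨k, rfl⟩
    refine Measure.map_eq_self_of_piecewise (hG g hg) (hG _ (G.inv_mem hg))
      (fun k => measurable_of_mem_exchanges (hmem k)) (fun k => hμ _ (hmem k))
      (fun k => measurableSet_eq_paths (hG g hg) (measurable_of_mem_exchanges (hmem k))) fun x => ?_
    obtain ⟨σ, hσ, hx⟩ := ((horb x (g x)).2 ⟨g, hg, rfl⟩).exists_exchange
    rw [he] at hσ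
    obtain ⟨k, rfl⟩ := hσ
    exact ⟨k, hx.symm⟩

/-- A finite measure is invariant if and only if the measure of a cylinder set depends only on the
last vertex. -/
theorem isInvariant_iff_cylinder {μ : Measure B.PathSpace} [IsFiniteMeasure μ] :
    IsInvariant μ ↔ ∀ (n : ℕ) (a b : B.PathSpace), B.r (a.edge n) = B.r (b.edge n) →
      μ (cylinder a (n + 1)) = μ (cylinder b (n + 1)) := by
  rw [isInvariant_iff_exchanges]
  constructor
  · intro hμ n a b h
    have h1 := hμ _ ⟨n, a, b, h, rfl⟩
    conv_rhs => rw [← h1]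
    rw [Measure.map_apply (measurable_of_mem_exchanges ⟨n, a, b, h, rfl⟩)
      (measurableSet_cylinder _ _)]
    congr 1
    ext x
    refine ⟨fun hx => exchange_mem_right (h := h) hx, fun hx => ?_⟩
    have := exchange_mem_left (h := h) hx
    rwa [Function.Involutive.coe_toPerm, exchange_involutive x] at this
  · rintro hμ _ ⟨n, a, b, h, rfl⟩
    have hm : Measurable (exchange_involutive (n := n) (a := a) (b := b) (h := h)).toPerm :=
      measurable_exchange (h := h)
    have : IsFiniteMeasure (μ.map (exchange_involutive (n := n) (a := a) (b := b) (h := h)).toPerm) :=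
      Measure.isFiniteMeasure_map μ _
    refine ext_of_generate_finite _ (generateFrom_cylindersFrom (n + 1))
      (cylindersFrom_isPiSystem (n + 1)) ?_ ?_
    · rintro _ ⟨y, m, hm', rfl⟩
      rw [Measure.map_apply hm (measurableSet_cylinder _ _), Function.Involutive.coe_toPerm,
        preimage_exchange_cylinder y hm']
      obtain ⟨m, rfl⟩ : ∃ l, m = l + 1 := ⟨m - 1, by omega⟩
      refine hμ m _ _ ?_
      -- The last vertex is read as the source of the next edge, which the exchange leaves alone
      -- even when the cylinder has length exactly $n+1$.
      rw [PathSpace.compat, PathSpace.compat, exchange_edge_of_gt y (by omega)]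
    · rw [Measure.map_apply hm MeasurableSet.univ, Set.preimage_univ]

theorem IsInvariant.add {μ ν : Measure B.PathSpace} (hμ : IsInvariant μ) (hν : IsInvariant ν) :
    IsInvariant (μ + ν) := by
  rw [isInvariant_iff_exchanges] at *
  intro σ hσ
  rw [Measure.map_add _ _ (measurable_of_mem_exchanges hσ), hμ σ hσ, hν σ hσ]

theorem IsInvariant.smul {μ : Measure B.PathSpace} (hμ : IsInvariant μ) (c : ℝ≥0) :
    IsInvariant (c • μ) := by
  rw [isInvariant_iff_exchanges] at *
  intro σ hσ
  rw [Measure.map_smul, hμ σ hσ]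

/-- The restriction of an invariant measure to a saturated set is invariant. -/
theorem IsInvariant.restrict {μ : Measure B.PathSpace} (hμ : IsInvariant μ) {S : Set B.PathSpace}
    (hS : MeasurableSet S) (hinv : ∀ x y, TailEquiv x y → (x ∈ S ↔ y ∈ S)) :
    IsInvariant (μ.restrict S) := by
  rw [isInvariant_iff_exchanges] at *
  intro σ hσ
  have hm := measurable_of_mem_exchanges hσ
  have hpre : σ ⁻¹' S = S := by
    ext x
    exact (hinv x (σ x) (tailEquiv_of_mem_exchanges hσ x)).symm
  conv_lhs => rw [← hpre]
  rw [← Measure.restrict_map hm hS, hμ σ hσ]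

end BratteliDiagram

/-! ### Measures with prescribed values on cylinder sets -/

/-- Normalization of $f$. When the total mass is 0, a point mass in $S$ is used, so that the
transition probabilities remain supported on admissible edges. -/
theorem PMF.exists_mul_sum_eq {ι : Type*} [Fintype ι] {S : Set ι} (hS : S.Nonempty)
    {f : ι → ENNReal} (hf : ∀ e, f e ≠ ⊤) (hfS : ∀ e ∉ S, f e = 0) :
    ∃ p : PMF ι, (∀ e ∉ S, p e = 0) ∧ ∀ e, (∑ e, f e) * p e = f e := by
  classical
  have hsum : (∑ e, f e) ≠ ⊤ := ENNReal.sum_ne_top.2 fun e _ => hf e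
  by_cases h0 : ∑ e, f e = 0
  · obtain ⟨e₀, he₀⟩ := hS
    refine ⟨PMF.pure e₀, fun e he => PMF.pure_apply_of_ne _ _ fun h => he (h ▸ he₀), fun e => ?_⟩
    rw [h0, zero_mul]
    exact ((Finset.sum_eq_zero_iff.1 h0) e (Finset.mem_univ e)).symm
  · refine ⟨PMF.normalize f (by rwa [tsum_fintype]) (by rwa [tsum_fintype]), fun e he => ?_,
      fun e => ?_⟩
    · rw [PMF.normalize_apply, hfS e he, zero_mul]
    · rw [PMF.normalize_apply, tsum_fintype, mul_left_comm, ENNReal.mul_inv_cancel h0 hsum, mul_one]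

namespace BratteliDiagram

variable {B : BratteliDiagram.{u, v}}

noncomputable instance (n : ℕ) : Fintype (B.E n) := Fintype.ofFinite _

open ProbabilityTheory in
/-- There is a probability measure on sequences of edges with the given initial and transition
probabilities. -/
theorem exists_markov_measure (p₀ : PMF (B.E 0)) (p : ∀ n, B.V (n + 1) → PMF (B.E (n + 1))) :
    ∃ P : Measure (∀ n, B.E n), IsProbabilityMeasure P ∧
      (∀ e, P {ω | ω 0 = e} = p₀ e) ∧
      (∀ n (a : ∀ n, B.E n), P {ω | ∀ i < n + 2, ω i = a i} =
        P {ω | ∀ i < n + 1, ω i = a i} * p n (B.r (a n)) (a (n + 1))) ∧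
      ∀ n, (∀ v e, B.s e ≠ v → p n v e = 0) → ∀ᵐ ω ∂P, B.r (ω n) = B.s (ω (n + 1)) := by
  let κ : ∀ n, Kernel (∀ i : Finset.Iic n, B.E i) (B.E (n + 1)) := fun n =>
    Kernel.ofFunOfCountable fun q => (p n (B.r (q ⟨n, Finset.mem_Iic.2 le_rfl⟩))).toMeasure
  have hκ : ∀ n q, κ n q = (p n (B.r (q ⟨n, Finset.mem_Iic.2 le_rfl⟩))).toMeasure :=
    fun n q => rfl
  have : ∀ n, IsMarkovKernel (κ n) := fun n => ⟨fun q => by rw [hκ]; infer_instance⟩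
  -- Ionescu-Tulcea, with kernels that see only the range of the last edge.
  set P := Kernel.trajMeasure p₀.toMeasure κ with hP
  have hcomp : ∀ n, P.map (Preorder.frestrictLe n) ⊗ₘ κ n =
      P.map fun x => (Preorder.frestrictLe n x, x (n + 1)) := fun n =>
    Kernel.map_frestrictLe_trajMeasure_compProd_eq_map_trajMeasure
  have hmeas : ∀ n, Measurable fun x : ∀ n, B.E n => (Preorder.frestrictLe (π := B.E) n x, x (n + 1)) :=
    fun n => (Preorder.measurable_frestrictLe n).prodMk (measurable_pi_apply _)
  have hpre : ∀ n (a : ∀ n, B.E n), {ω : ∀ n, B.E n | ∀ i < n + 1, ω i = a i} =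
      Preorder.frestrictLe (π := B.E) n ⁻¹' {Preorder.frestrictLe (π := B.E) n a} := by
    intro n a
    ext ω
    simp only [Set.mem_ofPred_eq, Set.mem_preimage, Set.mem_singleton_iff, funext_iff]
    exact ⟨fun h i => h i (Nat.lt_succ_of_le (Finset.mem_Iic.1 i.2)),
      fun h i hi => h ⟨i, Finset.mem_Iic.2 (Nat.lt_succ_iff.1 hi)⟩⟩
  refine ⟨P, inferInstance, fun e => ?_, fun n a => ?_, fun n hp => ?_⟩
  · let ψ : B.E 0 → ∀ i : Finset.Iic 0, B.E i :=
      (MeasurableEquiv.piUnique fun i : Finset.Iic 0 => B.E i).symm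
    have h0 : P.map (Preorder.frestrictLe 0) = p₀.toMeasure.map ψ := by
      rw [hP, Kernel.trajMeasure, Measure.map_comp _ _ (Preorder.measurable_frestrictLe 0),
        Kernel.traj_map_frestrictLe, Kernel.partialTraj_self, Measure.id_comp]
      rfl
    have h1 : {ω : ∀ n, B.E n | ω 0 = e} = Preorder.frestrictLe (π := B.E) 0 ⁻¹'
        {q | q ⟨0, Finset.mem_Iic.2 le_rfl⟩ = e} := rfl
    rw [h1, ← Measure.map_apply (Preorder.measurable_frestrictLe 0) MeasurableSet.of_discrete, h0,
      Measure.map_apply Measurable.of_discrete MeasurableSet.of_discrete,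
      ← PMF.toMeasure_apply_singleton p₀ e MeasurableSet.of_discrete]
    rfl
  · have h1 : {ω : ∀ n, B.E n | ∀ i < n + 2, ω i = a i} =
        (fun x => (Preorder.frestrictLe (π := B.E) n x, x (n + 1))) ⁻¹'
          ({Preorder.frestrictLe (π := B.E) n a} ×ˢ {a (n + 1)}) := by
      ext ω
      have h2 := Set.ext_iff.1 (hpre n a) ω
      simp only [Set.mem_ofPred_eq, Set.mem_preimage, Set.mem_prod, Set.mem_singleton_iff] at h2 ⊢
      rw [← h2]
      refine ⟨fun h => ⟨fun i hi => h i (by omega), h _ (by omega)⟩, fun h i hi => ?_⟩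
      rcases Nat.lt_succ_iff_lt_or_eq.1 hi with hlt | rfl
      · exact h.1 i hlt
      · exact h.2
    rw [h1, ← Measure.map_apply (hmeas n) MeasurableSet.of_discrete, ← hcomp,
      Measure.compProd_apply_prod MeasurableSet.of_discrete MeasurableSet.of_discrete,
      lintegral_singleton, hκ, PMF.toMeasure_apply_singleton _ _ MeasurableSet.of_discrete, hpre,
      Measure.map_apply (Preorder.measurable_frestrictLe n) MeasurableSet.of_discrete, mul_comm]
    rfl
  · have h1 : {ω : ∀ n, B.E n | ¬ B.r (ω n) = B.s (ω (n + 1))} =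
        (fun x => (Preorder.frestrictLe (π := B.E) n x, x (n + 1))) ⁻¹'
          {q | ¬ B.r (q.1 ⟨n, Finset.mem_Iic.2 le_rfl⟩) = B.s q.2} := rfl
    rw [ae_iff, h1, ← Measure.map_apply (hmeas n) MeasurableSet.of_discrete, ← hcomp,
      Measure.compProd_apply MeasurableSet.of_discrete]
    refine (lintegral_congr fun q => ?_).trans lintegral_zero
    rw [hκ, PMF.toMeasure_apply_eq_zero_iff _ MeasurableSet.of_discrete, Set.disjoint_left]
    exact fun e he hne => he (hp _ e fun h => hne h.symm)

/-- A compatible system of weights on the vertices defines a measure on the path space. -/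
theorem exists_measure_of_weights (y : ∀ n, B.V (n + 1) → ENNReal) (hfin : ∀ n v, y n v ≠ ⊤)
    (hy : ∀ n v, y n v = ∑ e : B.E (n + 1), open Classical in
      if B.s e = v then y (n + 1) (B.r e) else 0) :
    ∃ μ : Measure B.PathSpace, IsFiniteMeasure μ ∧
      ∀ n (a : B.PathSpace), μ (cylinder a (n + 1)) = y n (B.r (a.edge n)) := by
  classical
  obtain ⟨x₀⟩ := (inferInstance : Nonempty B.PathSpace)
  obtain ⟨p₀, -, hp₀⟩ := PMF.exists_mul_sum_eq (ι := B.E 0) (S := Set.univ)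
    ⟨x₀.edge 0, trivial⟩ (f := fun e => y 0 (B.r e)) (fun e => hfin _ _)
    (fun e he => absurd trivial he)
  -- The transition probability along $e$ is $y_{n+1}(r(e))/y_n(s(e))$, written without division;
  -- the products along a path telescope in `hcyl`.
  have hex : ∀ n v, ∃ q : PMF (B.E (n + 1)), (∀ e, B.s e ≠ v → q e = 0) ∧
      ∀ e, B.s e = v → y n v * q e = y (n + 1) (B.r e) := by
    intro n v
    obtain ⟨q, hq0, hq⟩ := PMF.exists_mul_sum_eq (ι := B.E (n + 1)) (S := {e | B.s e = v})
      (B.s_surjective (n + 1) v) (f := fun e => if B.s e = v then y (n + 1) (B.r e) else 0)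
      (fun e => by
        split_ifs
        · exact hfin _ _
        · exact ENNReal.zero_ne_top)
      (fun e he => if_neg he)
    refine ⟨q, hq0, fun e he => ?_⟩
    have := hq e
    rwa [← hy, if_pos he] at this
  choose p hp0 hp using hex
  obtain ⟨P, hP, hPinit, hPstep, hPcompat⟩ := exists_markov_measure p₀ p
  have hcompat : ∀ᵐ ω ∂P, ∀ n, B.r (ω n) = B.s (ω (n + 1)) :=
    ae_all_iff.2 fun n => hPcompat n (hp0 n)
  set M : ENNReal := ∑ e : B.E 0, y 0 (B.r e) with hM
  have hcyl : ∀ n (a : B.PathSpace), M * P {ω | ∀ i < n + 1, ω i = a.edge i} =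
      y n (B.r (a.edge n)) := by
    intro n a
    induction n with
    | zero =>
      rw [← hp₀ (a.edge 0), ← hPinit]
      simp
    | succ n ih => rw [hPstep n a.edge, ← mul_assoc, ih, hp _ _ _ (a.compat n).symm]
  -- Incompatible edge sequences form a null set and go to the default path $x_0$.
  let Φ : (∀ n, B.E n) → B.PathSpace := fun ω =>
    if h : ∀ n, B.r (ω n) = B.s (ω (n + 1)) then ⟨ω, h⟩ else x₀
  have hΦ : ∀ ω, (∀ n, B.r (ω n) = B.s (ω (n + 1))) → (Φ ω).edge = ω := fun ω h => by
    simp only [Φ, h, implies_true, dif_pos]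
  have hΦm : Measurable Φ := by
    refine measurable_of_edge fun n => ?_
    have heq : (fun ω => (Φ ω).edge n) =
        fun ω => if ∀ n, B.r (ω n) = B.s (ω (n + 1)) then ω n else x₀.edge n := by
      ext ω
      by_cases h : ∀ n, B.r (ω n) = B.s (ω (n + 1))
      · rw [if_pos h, hΦ ω h]
      · simp only [Φ, dif_neg h, if_neg h]
    rw [heq]
    refine Measurable.ite ?_ (measurable_pi_apply n) measurable_const
    have hset : {ω : ∀ n, B.E n | ∀ n, B.r (ω n) = B.s (ω (n + 1))} =
        ⋂ n, (fun ω : ∀ n, B.E n => (ω n, ω (n + 1))) ⁻¹' {q | B.r q.1 = B.s q.2} := by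
      ext ω
      simp
    rw [hset]
    exact MeasurableSet.iInter fun n =>
      ((measurable_pi_apply n).prodMk (measurable_pi_apply (n + 1))) MeasurableSet.of_discrete
  have hMfin : M ≠ ⊤ := ENNReal.sum_ne_top.2 fun e _ => hfin _ _
  refine ⟨M • P.map Φ, ⟨?_⟩, fun n a => ?_⟩
  · rw [Measure.smul_apply, Measure.map_apply hΦm MeasurableSet.univ, Set.preimage_univ,
      measure_univ, smul_eq_mul, mul_one]
    exact hMfin.lt_top
  · rw [Measure.smul_apply, Measure.map_apply hΦm (measurableSet_cylinder _ _), smul_eq_mul,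
      ← hcyl n a]
    congr 1
    refine measure_congr ?_
    filter_upwards [hcompat] with ω hω
    refine propext ?_
    change (∀ i < n + 1, (Φ ω).edge i = a.edge i) ↔ _
    rw [hΦ ω hω]
    rfl

/-! ### Invariant measures and the core -/

theorem measureReal_eq_sum_edge (μ : Measure B.PathSpace) [IsFiniteMeasure μ] (n : ℕ)
    (S : Set B.PathSpace) :
    μ.real S = ∑ e : B.E n, μ.real (S ∩ {x | x.edge n = e}) := by
  have h := sum_measureReal_preimage_singleton (μ := μ.restrict S) (Finset.univ : Finset (B.E n))
    (f := fun x : B.PathSpace => x.edge n) (fun e _ => measurable_edge n MeasurableSet.of_discrete)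
  rw [Finset.coe_univ, Set.preimage_univ, measureReal_restrict_apply_univ] at h
  rw [← h]
  refine Finset.sum_congr rfl fun e _ => ?_
  rw [measureReal_restrict_apply (measurable_edge n MeasurableSet.of_discrete), Set.inter_comm]
  rfl

variable {N : ℕ} (num : ∀ n, Fin N ≃ B.V (n + 1))

/-- The measures of the cylinder sets that end at the vertices of level `n + 1`. -/
noncomputable def levelVector (μ : Measure B.PathSpace) (n : ℕ) : Fin N → ℝ := fun i =>
  μ.real (cylinder (exists_path_vertex n (num n i)).choose (n + 1))

variable {num}

theorem levelVector_nonneg (μ : Measure B.PathSpace) (n : ℕ) : 0 ≤ levelVector num μ n :=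
  fun _ => measureReal_nonneg

theorem IsInvariant.measureReal_cylinder {μ : Measure B.PathSpace} [IsFiniteMeasure μ]
    (hμ : IsInvariant μ) (n : ℕ) (a : B.PathSpace) :
    μ.real (cylinder a (n + 1)) = levelVector num μ n ((num n).symm (B.r (a.edge n))) := by
  have h := (exists_path_vertex n (num n ((num n).symm (B.r (a.edge n))))).choose_spec
  rw [Equiv.apply_symm_apply] at h
  rw [levelVector, Measure.real, Measure.real, isInvariant_iff_cylinder.1 hμ n _ _ h.symm]
  simp only [Equiv.apply_symm_apply]

/-- Splitting a cylinder by its next edge; this is the backward orbit relation, in the edge form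
matched by `IsStationary.mulVec_apply`. -/
theorem IsInvariant.levelVector_eq {μ : Measure B.PathSpace} [IsFiniteMeasure μ]
    (hμ : IsInvariant μ) (n : ℕ) (i : Fin N) : levelVector num μ n i =
      ∑ e : B.E (n + 1), open Classical in if B.s e = num n i then
        levelVector num μ (n + 1) ((num (n + 1)).symm (B.r e)) else 0 := by
  classical
  obtain ⟨a, ha⟩ := exists_path_vertex n (num n i)
  have h := hμ.measureReal_cylinder (num := num) n a
  rw [ha, Equiv.symm_apply_apply] at h
  rw [← h, measureReal_eq_sum_edge μ (n + 1)]
  refine Finset.sum_congr rfl fun e _ => ?_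
  split_ifs with he
  · obtain ⟨y, hya, rfl⟩ := exists_path_append a n e (ha.trans he.symm)
    rw [← hμ.measureReal_cylinder (n + 1) y]
    congr 1
    ext z
    constructor
    · rintro ⟨hz, hze⟩ i hi
      rcases Nat.lt_succ_iff_lt_or_eq.1 hi with hlt | rfl
      · rw [hz i hlt, hya i hlt]
      · exact hze
    · exact fun hz => ⟨fun i hi => (hz i (by omega)).trans (hya i hi), hz _ (by omega)⟩
  · have hempty : cylinder a (n + 1) ∩ {x | x.edge (n + 1) = e} = ∅ := by
      rw [Set.eq_empty_iff_forall_notMem]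
      rintro z ⟨hz, rfl⟩
      refine he ?_
      rw [← z.compat n, hz n (by omega), ha]
    rw [hempty, measureReal_empty]

theorem height₁_eq_sum (w : B.V 1) : (B.height₁ w : ℝ) =
    ∑ e : B.E 0, open Classical in if B.r e = w then (1 : ℝ) else 0 := by
  classical
  rw [height₁, Nat.card_eq_fintype_card, Fintype.card_subtype, Finset.sum_boole]

theorem height₁_pos (w : B.V 1) : 0 < B.height₁ w := by
  obtain ⟨e, he⟩ := B.r_surjective 0 w
  have : Nonempty {e : B.E 0 // B.r e = w} := ⟨⟨e, he⟩⟩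
  exact Nat.card_pos

theorem IsInvariant.measureReal_tower {μ : Measure B.PathSpace} [IsFiniteMeasure μ]
    (hμ : IsInvariant μ) (i : Fin N) :
    μ.real (tower₁ (num 0 i)) = B.height₁ (num 0 i) * levelVector num μ 0 i := by
  classical
  rw [measureReal_eq_sum_edge μ 0, height₁_eq_sum, Finset.sum_mul]
  refine Finset.sum_congr rfl fun e _ => ?_
  obtain ⟨y, rfl⟩ := exists_path_edge 0 e
  split_ifs with he
  · have h := hμ.measureReal_cylinder (num := num) 0 y
    rw [he, Equiv.symm_apply_apply] at h
    rw [one_mul, ← h]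
    congr 1
    ext z
    constructor
    · rintro ⟨-, hz⟩ j hj
      obtain rfl : j = 0 := by omega
      exact hz
    · intro hz
      have h0 := hz 0 (by omega)
      exact ⟨(congrArg B.r h0).trans he, h0⟩
  · have hempty : tower₁ (num 0 i) ∩ {x | x.edge 0 = y.edge 0} = ∅ := by
      rw [Set.eq_empty_iff_forall_notMem]
      rintro z ⟨hz, hzy⟩
      exact he ((congrArg B.r hzy).symm.trans hz)
    rw [hempty, measureReal_empty, zero_mul]

theorem IsInvariant.measureVector_eq {μ : Measure B.PathSpace} [IsFiniteMeasure μ]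
    (hμ : IsInvariant μ) : measureVector num μ = levelVector num μ 0 := by
  ext i
  have h : (B.height₁ (num 0 i) : ℝ) ≠ 0 := Nat.cast_ne_zero.2 (height₁_pos _).ne'
  rw [measureVector, hμ.measureReal_tower, mul_div_cancel_left₀ _ h]

/-- The towers over level 1 partition the path space, so the normalization in `normalizedCore` is
the total mass. -/
theorem sum_height_mul_measureVector (μ : Measure B.PathSpace) [IsFiniteMeasure μ] :
    ∑ i, (B.height₁ (num 0 i) : ℝ) * measureVector num μ i = μ.real Set.univ := by
  have h := sum_measureReal_preimage_singleton (μ := μ) (Finset.univ : Finset (Fin N))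
    (f := fun x : B.PathSpace => (num 0).symm (B.r (x.edge 0)))
    (fun i _ => (measurable_edge 0) (MeasurableSet.of_discrete
      (s := {e | (num 0).symm (B.r e) = i})))
  rw [Finset.coe_univ, Set.preimage_univ] at h
  rw [← h]
  refine Finset.sum_congr rfl fun i _ => ?_
  have h0 : (B.height₁ (num 0 i) : ℝ) ≠ 0 := Nat.cast_ne_zero.2 (height₁_pos _).ne'
  rw [measureVector, mul_div_cancel₀ _ h0]
  congr 1
  ext x
  simp [tower₁, Equiv.symm_apply_eq]

/-! ### Stationary diagrams: invariant measures as core vectors -/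

section Stationary

variable {F : Matrix (Fin N) (Fin N) ℕ}

theorem IsStationary.mulVec_apply (hstat : B.IsStationary F num) (n : ℕ) (g : Fin N → ℝ)
    (i : Fin N) : ((F.map (Nat.cast : ℕ → ℝ))ᵀ *ᵥ g) i =
      ∑ e : B.E (n + 1), open Classical in
        if B.s e = num n i then g ((num (n + 1)).symm (B.r e)) else 0 := by
  classical
  have hF : ∀ j, (F j i : ℝ) =
      ∑ e : B.E (n + 1), if B.r e = num (n + 1) j ∧ B.s e = num n i then (1 : ℝ) else 0 := by
    intro j
    rw [← hstat n j i, incidence, Nat.card_eq_fintype_card, Fintype.card_subtype, Finset.sum_boole]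
  simp only [Matrix.mulVec, dotProduct, Matrix.transpose_apply, Matrix.map_apply, hF,
    Finset.sum_mul]
  rw [Finset.sum_comm]
  refine Finset.sum_congr rfl fun e _ => ?_
  rw [Finset.sum_eq_single ((num (n + 1)).symm (B.r e))]
  · simp
  · intro j _ hj
    have : ¬ B.r e = num (n + 1) j := fun h => hj (by rw [h, Equiv.symm_apply_apply])
    simp [this]
  · exact fun h => absurd (Finset.mem_univ _) h

theorem IsStationary.exists_pos (hstat : B.IsStationary F num) (j : Fin N) :
    ∃ i, 0 < (F.map (Nat.cast : ℕ → ℝ))ᵀ i j := by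
  obtain ⟨e, he⟩ := B.r_surjective 1 (num 1 j)
  refine ⟨(num 0).symm (B.s e), ?_⟩
  rw [Matrix.transpose_apply, Matrix.map_apply, Nat.cast_pos, ← hstat 0]
  have : Nonempty {e' : B.E 1 // B.r e' = num 1 j ∧ B.s e' = num 0 ((num 0).symm (B.s e))} :=
    ⟨⟨e, he, by rw [Equiv.apply_symm_apply]⟩⟩
  exact Nat.card_pos

theorem IsInvariant.isBackwardOrbit (hstat : B.IsStationary F num) {μ : Measure B.PathSpace}
    [IsFiniteMeasure μ] (hμ : IsInvariant μ) :
    IsBackwardOrbit (F.map (Nat.cast : ℕ → ℝ))ᵀ (levelVector num μ) := by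
  refine ⟨levelVector_nonneg μ, fun n => ?_⟩
  ext i
  rw [hstat.mulVec_apply n, hμ.levelVector_eq]

theorem IsInvariant.measureVector_mem_core (hstat : B.IsStationary F num) {μ : Measure B.PathSpace}
    [IsFiniteMeasure μ] (hμ : IsInvariant μ) :
    measureVector num μ ∈ matrixCore (F.map (Nat.cast : ℕ → ℝ))ᵀ := by
  rw [hμ.measureVector_eq]
  exact (hμ.isBackwardOrbit hstat).mem_core 0

/-- The first level vector fixes the whole backward orbit, hence the mass of every cylinder of
positive length, and these form a generating π-system. -/
theorem IsInvariant.eq_of_measureVector_eq (hstat : B.IsStationary F num)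
    {μ ν : Measure B.PathSpace} [IsFiniteMeasure μ] [IsFiniteMeasure ν] (hμ : IsInvariant μ)
    (hν : IsInvariant ν) (h : measureVector num μ = measureVector num ν) : μ = ν := by
  have hlevel := (hμ.isBackwardOrbit hstat).unique (hν.isBackwardOrbit hstat)
    (by rw [← hμ.measureVector_eq, ← hν.measureVector_eq, h])
  refine ext_of_generate_finite _ (generateFrom_cylindersFrom 1) (cylindersFrom_isPiSystem 1) ?_ ?_
  · rintro _ ⟨a, m, hm, rfl⟩
    obtain ⟨m, rfl⟩ : ∃ l, m = l + 1 := ⟨m - 1, by omega⟩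
    rw [← measureReal_eq_measureReal_iff, hμ.measureReal_cylinder (num := num),
      hν.measureReal_cylinder (num := num), hlevel]
  · rw [← measureReal_eq_measureReal_iff, ← sum_height_mul_measureVector (num := num),
      ← sum_height_mul_measureVector (num := num), h]

theorem exists_isInvariant_of_mem_core (hstat : B.IsStationary F num) {x : Fin N → ℝ}
    (hx : x ∈ matrixCore (F.map (Nat.cast : ℕ → ℝ))ᵀ) :
    ∃ μ : Measure B.PathSpace, IsFiniteMeasure μ ∧ IsInvariant μ ∧ measureVector num μ = x := by
  classical
  obtain ⟨y, hy, rfl⟩ := exists_backwardOrbit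
    (A := (F.map (Nat.cast : ℕ → ℝ))ᵀ) (fun i j => Nat.cast_nonneg _) hx
  obtain ⟨μ, hμ, hcyl⟩ := exists_measure_of_weights (B := B)
    (fun n v => ENNReal.ofReal (y n ((num n).symm v))) (fun n v => ENNReal.ofReal_ne_top) (by
      intro n v
      have h := hstat.mulVec_apply n (y (n + 1)) ((num n).symm v)
      rw [hy.2, Equiv.apply_symm_apply] at h
      rw [h, ENNReal.ofReal_sum_of_nonneg]
      · refine Finset.sum_congr rfl fun e _ => ?_
        split_ifs
        · rfl
        · exact ENNReal.ofReal_zero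
      · intro e _
        split_ifs
        · exact hy.1 _ _
        · exact le_rfl)
  have hinv : IsInvariant μ := isInvariant_iff_cylinder.2 fun n a b hab => by
    rw [hcyl, hcyl, hab]
  refine ⟨μ, hμ, hinv, ?_⟩
  rw [hinv.measureVector_eq]
  ext i
  have h := (exists_path_vertex 0 (num 0 i)).choose_spec
  rw [levelVector, Measure.real, hcyl, h, Equiv.symm_apply_apply, ENNReal.toReal_ofReal (hy.1 0 i)]

end Stationary

end BratteliDiagram

/-! ### Ergodicity and extremality -/

theorem rayOf_smul {N : ℕ} {x : Fin N → ℝ} {c : ℝ} (hc : 0 < c) : rayOf (c • x) = rayOf x := by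
  ext y
  constructor
  · rintro ⟨a, ha, rfl⟩
    exact ⟨a * c, by positivity, smul_smul _ _ _⟩
  · rintro ⟨a, ha, rfl⟩
    exact ⟨a / c, by positivity, by rw [smul_smul, div_mul_cancel₀ _ hc.ne']⟩

namespace BratteliDiagram

variable {B : BratteliDiagram.{u, v}} {N : ℕ} {num : ∀ n, Fin N ≃ B.V (n + 1)}

theorem measureVector_add (μ ν : Measure B.PathSpace) [IsFiniteMeasure μ] [IsFiniteMeasure ν] :
    measureVector num (μ + ν) = measureVector num μ + measureVector num ν := by
  ext i
  rw [Pi.add_apply, measureVector, measureVector, measureVector, ← add_div,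
    ← measureReal_add_apply]

theorem measureVector_smul (μ : Measure B.PathSpace) (c : ℝ≥0) :
    measureVector num (c • μ) = c • measureVector num μ := by
  ext i
  simp only [measureVector, Pi.smul_apply, measureReal_nnreal_smul_apply, NNReal.smul_def,
    smul_eq_mul, mul_div_assoc]

/-- A function that is almost everywhere invariant under all exchanges is almost everywhere constant
for an ergodic measure. -/
theorem IsErgodic.ae_eq_const {μ : Measure B.PathSpace} (hμ : IsErgodic μ)
    {f : B.PathSpace → ENNReal} (hf : Measurable f)
    (hinv : ∀ σ ∈ exchanges B, f ∘ σ =ᵐ[μ] f) : ∃ c, f =ᵐ[μ] fun _ => c := by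
  have hall : ∀ᵐ x ∂μ, ∀ σ ∈ exchanges B, f (σ x) = f x :=
    (ae_ball_iff exchanges_countable).2 fun σ hσ => hinv σ hσ
  refine Filter.exists_eventuallyEq_const_of_forall_separating MeasurableSet fun U hU => ?_
  -- $T$ consists of the points whose whole tail class is sent into $U$. It is exactly saturated, as
  -- `IsErgodic` requires, and agrees almost everywhere with $f^{-1}(U)$ because there are only
  -- countably many exchanges.
  set T : Set B.PathSpace := ⋂ σ ∈ exchanges B, σ ⁻¹' (f ⁻¹' U) with hT
  have hTm : MeasurableSet T := MeasurableSet.biInter exchanges_countable fun σ hσ =>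
    measurable_of_mem_exchanges hσ (hf hU)
  have hmem : ∀ x, x ∈ T ↔ ∀ y, TailEquiv x y → f y ∈ U := by
    intro x
    simp only [hT, Set.mem_iInter, Set.mem_preimage]
    refine ⟨fun h y hxy => ?_, fun h σ hσ => h _ (tailEquiv_of_mem_exchanges hσ x)⟩
    obtain ⟨σ, hσ, rfl⟩ := hxy.exists_exchange
    exact h σ hσ
  have hTinv : ∀ x y, TailEquiv x y → (x ∈ T ↔ y ∈ T) := by
    intro x y hxy
    rw [hmem, hmem]
    exact ⟨fun h z hz => h z (hxy.trans hz), fun h z hz => h z (hxy.symm.trans hz)⟩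
  have hTf : ∀ᵐ x ∂μ, x ∈ T ↔ f x ∈ U := by
    filter_upwards [hall] with x hx
    simp only [hT, Set.mem_iInter, Set.mem_preimage]
    refine ⟨fun h => (hmem x).1 (by simpa [hT] using h) x (TailEquiv.refl x), fun h σ hσ => ?_⟩
    rwa [hx σ hσ]
  rcases hμ T hTm hTinv with h | h
  · right
    filter_upwards [hTf, measure_eq_zero_iff_ae_notMem.1 h] with x hx hxT
    exact fun hU => hxT (hx.2 hU)
  · left
    filter_upwards [hTf, measure_eq_zero_iff_ae_notMem.1 h] with x hx hxT
    exact hx.1 (not_not.1 hxT)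

/-- An invariant measure that is dominated by an ergodic one is a multiple of it. -/
theorem IsErgodic.eq_smul_of_absolutelyContinuous {μ ν : Measure B.PathSpace} [IsProbabilityMeasure μ]
    [IsFiniteMeasure ν] (hμ : IsErgodic μ) (hμi : IsInvariant μ) (hνi : IsInvariant ν)
    (hac : ν ≪ μ) : ∃ c : ℝ≥0, ν = c • μ := by
  rw [isInvariant_iff_exchanges] at hμi hνi
  obtain ⟨c, hc⟩ := hμ.ae_eq_const (Measure.measurable_rnDeriv ν μ) fun σ hσ =>
    MeasurePreserving.rnDeriv_comp_aeEq ⟨measurable_of_mem_exchanges hσ, hνi σ hσ⟩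
      ⟨measurable_of_mem_exchanges hσ, hμi σ hσ⟩
  have hν : ν = c • μ := by
    rw [← withDensity_const, ← withDensity_congr_ae hc, Measure.withDensity_rnDeriv_eq _ _ hac]
  have hctop : c ≠ ⊤ := by
    have h := measure_ne_top ν Set.univ
    rwa [hν, Measure.smul_apply, measure_univ, smul_eq_mul, mul_one] at h
  lift c to ℝ≥0 using hctop
  exact ⟨c, hν⟩

variable {F : Matrix (Fin N) (Fin N) ℕ}

/-- A decomposition of the vector in the core lifts to $\mu=\nu+\nu'$ with $\nu\ll\mu$, and
ergodicity makes $\nu$ a multiple of $\mu$. Conversely, for saturated $S$ extremality gives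
$\mu|_S=t\mu$; evaluation at $S^c$ yields $t=0$ or $\mu(S^c)=0$. -/
theorem isErgodic_iff_isExtremeVector (hstat : B.IsStationary F num) {μ : Measure B.PathSpace}
    [IsProbabilityMeasure μ] (hμ : IsInvariant μ) :
    IsErgodic μ ↔ IsExtremeVector (matrixCore (F.map (Nat.cast : ℕ → ℝ))ᵀ) (measureVector num μ) := by
  have hA : ∀ i j, 0 ≤ (F.map (Nat.cast : ℕ → ℝ))ᵀ i j := fun i j => Nat.cast_nonneg _
  rw [isExtremeVector_iff (matrixCore_isConvexCone hA) fun x hx => matrixCore_nonneg hA hx]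
  constructor
  · intro herg
    refine ⟨hμ.measureVector_mem_core hstat, fun h0 => ?_, fun y hy hxy => ?_⟩
    · have h := sum_height_mul_measureVector (num := num) μ
      rw [h0] at h
      simp at h
    · obtain ⟨ν, hν, hνi, rfl⟩ := exists_isInvariant_of_mem_core hstat hy
      obtain ⟨ν', hν', hνi', hvec⟩ := exists_isInvariant_of_mem_core hstat hxy
      have hsum : ν + ν' = μ := by
        refine (hνi.add hνi').eq_of_measureVector_eq hstat hμ ?_
        rw [measureVector_add, hvec, add_sub_cancel]
      have hac : ν ≪ μ := by
        rw [← hsum]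
        exact Measure.AbsolutelyContinuous.rfl.add_right ν'
      obtain ⟨c, rfl⟩ := herg.eq_smul_of_absolutelyContinuous hμ hνi hac
      exact ⟨c, c.2, measureVector_smul μ c⟩
  · rintro ⟨-, -, hext⟩ S hS hinv
    have hrS := hμ.restrict hS hinv
    have hrSc := hμ.restrict hS.compl fun x y hxy => not_congr (hinv x y hxy)
    have hsum : measureVector num (μ.restrict S) + measureVector num (μ.restrict Sᶜ) =
        measureVector num μ := by
      rw [← measureVector_add, Measure.restrict_add_restrict_compl hS]
    obtain ⟨t, ht, hvec⟩ := hext _ (hrS.measureVector_mem_core hstat)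
      (by rw [← hsum, add_sub_cancel_left]; exact hrSc.measureVector_mem_core hstat)
    lift t to ℝ≥0 using ht
    have heq : μ.restrict S = t • μ := by
      refine hrS.eq_of_measureVector_eq hstat (hμ.smul t) ?_
      rw [measureVector_smul, hvec]
      rfl
    have hSc := congrArg (fun m : Measure B.PathSpace => m Sᶜ) heq
    simp only [Measure.restrict_apply hS.compl, Set.compl_inter_self, measure_empty,
      Measure.smul_apply] at hSc
    rcases (smul_eq_zero.1 hSc.symm) with h | h
    · left
      rw [← Measure.restrict_apply_self, heq, h, zero_smul, Measure.coe_zero, Pi.zero_apply]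
    · exact Or.inr h

theorem bijOn_measureVector (hstat : B.IsStationary F num) :
    Set.BijOn (measureVector num) B.invariantProb
      (normalizedCore (F.map (Nat.cast : ℕ → ℝ))ᵀ fun i => B.height₁ (num 0 i)) := by
  refine ⟨?_, ?_, ?_⟩
  · rintro μ ⟨hμ, hinv⟩
    exact ⟨hinv.measureVector_mem_core hstat, by
      rw [sum_height_mul_measureVector, probReal_univ]⟩
  · rintro μ ⟨hμ, hinv⟩ ν ⟨hν, hinv'⟩ h
    exact hinv.eq_of_measureVector_eq hstat hinv' h
  · rintro x ⟨hx, hsum⟩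
    obtain ⟨μ, hμ, hinv, rfl⟩ := exists_isInvariant_of_mem_core hstat hx
    rw [sum_height_mul_measureVector, measureReal_def, ENNReal.toReal_eq_one_iff] at hsum
    exact ⟨μ, ⟨⟨hsum⟩, hinv⟩, rfl⟩

end BratteliDiagram

open BratteliDiagram in
theorem mainTheorem1 (B : BratteliDiagram.{u, v}) {N : ℕ} (F : Matrix (Fin N) (Fin N) ℕ)
    (num : ∀ n, Fin N ≃ B.V (n + 1)) (hstat : B.IsStationary F num) (haper : B.IsAperiodic)
    (hprim : HasPrimitiveBlocks (F.map (Nat.cast : ℕ → ℝ)))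
    (A : Matrix (Fin N) (Fin N) ℝ) (hA : A = (F.map (Nat.cast : ℕ → ℝ))ᵀ) :
    -- one-to-one correspondence
    Set.BijOn (BratteliDiagram.measureVector num) B.invariantProb
      (normalizedCore A fun i => B.height₁ (num 0 i)) ∧
    -- the correspondence is affine
    (∀ μ ∈ B.invariantProb, ∀ ν ∈ B.invariantProb, ∀ a b : ℝ≥0, a + b = 1 →
      a • μ + b • ν ∈ B.invariantProb ∧
      BratteliDiagram.measureVector num (a • μ + b • ν) =
        a • BratteliDiagram.measureVector num μ + b • BratteliDiagram.measureVector num ν) ∧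
    -- ergodic measures correspond to the extreme vectors of the core
    (∀ μ ∈ B.invariantProb, BratteliDiagram.IsErgodic μ ↔
      IsExtremeVector (matrixCore A) (BratteliDiagram.measureVector num μ)) ∧
    -- the extreme vectors of the core are the distinguished eigenvectors
    (∀ x, IsExtremeVector (matrixCore A) x ↔
      ∃ α : ComClass A, IsDistinguished A α ∧ IsDistinguishedEigenvector A α x) ∧
    -- every distinguished class gives exactly one ergodic measure
    (∀ α : ComClass A, IsDistinguished A α →
      ∃! μ, μ ∈ B.ergodicProb ∧
        IsDistinguishedEigenvector A α (BratteliDiagram.measureVector num μ)) ∧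
    -- the number of ergodic measures
    B.ergodicProb.Finite ∧
    B.ergodicProb.ncard = (extremeRays (matrixCore A)).ncard ∧
    B.ergodicProb.ncard = {α : ComClass A | IsDistinguished A α}.ncard := by
  have hbij := bijOn_measureVector hstat
  have herg : ∀ μ ∈ B.invariantProb, IsErgodic μ ↔
      IsExtremeVector (matrixCore A) (measureVector num μ) := by
    rintro μ ⟨hμ, hinv⟩
    rw [hA]
    exact isErgodic_iff_isExtremeVector hstat hinv
  have hA0 : ∀ i j, 0 ≤ A i j := fun i j => by
    rw [hA]
    exact Nat.cast_nonneg _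
  have hcol : ∀ j, ∃ i, 0 < A i j := fun j => by
    rw [hA]
    exact hstat.exists_pos j
  have hprimA : HasPrimitiveBlocks A := by
    rw [hA]
    exact hprim.transpose
  rw [← hA] at hbij
  obtain ⟨hext, hexist, huniq⟩ := extreme_matrixCore hA0 hprimA hcol
  have hsmul : ∀ (x : Fin N → ℝ) (c : ℝ), ∑ w, (B.height₁ (num 0 w) : ℝ) * (c • x) w =
      c * ∑ w, (B.height₁ (num 0 w) : ℝ) * x w := fun x c => by
    rw [Finset.mul_sum]
    exact Finset.sum_congr rfl fun w _ => mul_left_comm _ _ _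
  -- every extreme vector has a unique normalized multiple
  have hnorm : ∀ x, IsExtremeVector (matrixCore A) x →
      ∃ c : ℝ, 0 < c ∧ ∑ w, (B.height₁ (num 0 w) : ℝ) * (c • x) w = 1 := by
    intro x hx
    have hx0 := matrixCore_nonneg hA0 hx.1
    obtain ⟨i, hi⟩ := Function.ne_iff.1 hx.2.1
    have hpos : 0 < ∑ w, (B.height₁ (num 0 w) : ℝ) * x w :=
      Finset.sum_pos' (fun w _ => mul_nonneg (Nat.cast_nonneg _) (hx0 w))
        ⟨i, Finset.mem_univ i, mul_pos (Nat.cast_pos.2 (height₁_pos _))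
          (lt_of_le_of_ne (hx0 i) (Ne.symm hi))⟩
    exact ⟨_, inv_pos.2 hpos, by rw [hsmul, inv_mul_cancel₀ hpos.ne']⟩
  -- On the normalized slice proportional vectors coincide; this turns uniqueness up to scaling into
  -- uniqueness of measures.
  have hscale : ∀ x y : Fin N → ℝ, ∀ c : ℝ, y = c • x →
      ∑ w, (B.height₁ (num 0 w) : ℝ) * x w = 1 →
      ∑ w, (B.height₁ (num 0 w) : ℝ) * y w = 1 → y = x := by
    rintro x _ c rfl hx hy
    rw [hsmul, hx, mul_one] at hy
    rw [hy, one_smul]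
  have hclass : ∀ α : ComClass A, IsDistinguished A α →
      ∃! μ, μ ∈ B.ergodicProb ∧ IsDistinguishedEigenvector A α (measureVector num μ) := by
    intro α hα
    obtain ⟨x, hx⟩ := hexist α hα
    obtain ⟨c, hc, hsum⟩ := hnorm x ((hext x).2 ⟨α, hα, hx⟩)
    have hcx := hx.smul hc
    have hcext := (hext _).2 ⟨α, hα, hcx⟩
    obtain ⟨μ, hμ, hvec⟩ := hbij.surjOn ⟨hcext.1, hsum⟩
    refine ⟨μ, ⟨⟨hμ, (herg μ hμ).2 (hvec ▸ hcext)⟩, hvec ▸ hcx⟩, ?_⟩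
    rintro ν ⟨⟨hν, -⟩, hνα⟩
    obtain ⟨d, -, hd⟩ := huniq α _ _ hα (hvec ▸ hcx) hνα
    exact hbij.injOn hν hμ (hscale _ _ d hd (hbij.mapsTo hμ).2 (hbij.mapsTo hν).2)
  have hcover : ∀ μ ∈ B.ergodicProb, ∃ α, IsDistinguished A α ∧
      IsDistinguishedEigenvector A α (measureVector num μ) := fun μ hμ =>
    (hext _).1 ((herg μ hμ.1).1 hμ.2)
  choose g hg hguniq using hclass
  have hsurj : ∀ μ ∈ B.ergodicProb, ∃ (α : ComClass A) (hα : α ∈ {α | IsDistinguished A α}),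
      g α hα = μ := by
    intro μ hμ
    obtain ⟨α, hα, hμα⟩ := hcover μ hμ
    exact ⟨α, hα, (hguniq α hα μ ⟨hμ, hμα⟩).symm⟩
  have hfin : B.ergodicProb.Finite := by
    refine (Set.finite_range fun α : {α : ComClass A // IsDistinguished A α} => g α.1 α.2).subset ?_
    intro μ hμ
    obtain ⟨α, hα, rfl⟩ := hsurj μ hμ
    exact ⟨⟨α, hα⟩, rfl⟩
  refine ⟨hbij, ?_, herg, hext, fun α hα => ⟨g α hα, hg α hα, hguniq α hα⟩, hfin, ?_, ?_⟩
  · rintro μ ⟨hμ, hμi⟩ ν ⟨hν, hνi⟩ a b hab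
    refine ⟨⟨⟨?_⟩, (hμi.smul a).add (hνi.smul b)⟩, ?_⟩
    · rw [Measure.add_apply, Measure.smul_apply, Measure.smul_apply, measure_univ, measure_univ,
        ENNReal.smul_def, ENNReal.smul_def, smul_eq_mul, smul_eq_mul, mul_one, mul_one,
        ← ENNReal.coe_add, hab, ENNReal.coe_one]
    · rw [measureVector_add, measureVector_smul, measureVector_smul]
  · refine Set.ncard_congr (fun μ _ => rayOf (measureVector num μ)) ?_ ?_ ?_
    · exact fun μ hμ => ⟨_, (herg μ hμ.1).1 hμ.2, rfl⟩
    · intro μ ν hμ hν h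
      have hmem : measureVector num μ ∈ rayOf (measureVector num ν) := by
        rw [← h]
        exact ⟨1, zero_le_one, (one_smul ℝ _).symm⟩
      obtain ⟨c, -, hc⟩ := hmem
      exact hbij.injOn hμ.1 hν.1 (hscale _ _ c hc (hbij.mapsTo hν.1).2 (hbij.mapsTo hμ.1).2)
    · rintro _ ⟨x, hx, rfl⟩
      obtain ⟨c, hc, hsum⟩ := hnorm x hx
      obtain ⟨α, hα, hxα⟩ := (hext x).1 hx
      have hcext := (hext _).2 ⟨α, hα, hxα.smul hc⟩
      obtain ⟨μ, hμ, hvec⟩ := hbij.surjOn ⟨hcext.1, hsum⟩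
      exact ⟨μ, ⟨hμ, (herg μ hμ).2 (hvec ▸ hcext)⟩, by rw [hvec, rayOf_smul hc]⟩
  -- The map from classes to measures is injective because the support of a distinguished
  -- eigenvector determines its class.
  · refine (Set.ncard_congr g (fun α hα => (hg α hα).1) (fun α β hα hβ h => ?_) ?_).symm
    · have h1 := (hg α hα).2
      rw [h] at h1
      exact h1.class_unique (hg β hβ).2
    · exact hsurj
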